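/- Let $n \ge 6$ and $k \ge 0$ be integers with $k \le \lfloor n/3\rfloor - 1$. Then there is a set $P$ of $n$ points in the Euclidean plane in general position (no three points collinear, no four points cocircular) that has exactly one order-$k$ Delaunay triangulation, namely its Delaunay triangulation. Here a triangulation of $P$ is a subdivision of the convex hull of $P$ into triangles, meeting along common faces, whose set of vertices is exactly $P$. It is order-$k$ Delaunay if the circumcircle of each of its triangles contains at most $k$ points of $P$ in its interior, and it is the Delaunay triangulation if these circumcircles contain no point of $P$ in their interior. -/

import Mathlib

/-- The Euclidean plane. -/
abbrev Plane : Type := EuclideanSpace ℝ (Fin 2)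

/-- A finite planar point set is in general position if no three of its points are collinear and
no four of its points are cocircular. -/
def InGeneralPosition (P : Finset Plane) : Prop :=
  (∀ t ⊆ P, t.card = 3 → ¬ Collinear ℝ (t : Set Plane)) ∧
  (∀ t ⊆ P, t.card = 4 → ¬ EuclideanGeometry.Cospherical (t : Set Plane))

/-- A triangulation of `P`: a geometric simplicial complex that subdivides the convex hull of `P`
into triangles (every face is a face of some triangle of the complex) and whose vertices are
exactly the points of `P`. -/
structure IsTriangulation (P : Finset Plane) (K : Geometry.SimplicialComplex ℝ Plane) : Prop where
  vertices_eq : K.vertices = (P : Set Plane)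
  space_eq : K.space = convexHull ℝ (P : Set Plane)
  face_of_triangle : ∀ s ∈ K.faces, ∃ t ∈ K.faces, s ⊆ t ∧ t.card = 3

open Classical in
/-- A triangle with vertex set `t` is order-`k` Delaunay with respect to `P` if its circumcircle
contains at most `k` points of `P` in its interior. For three noncollinear points the circle `C`
through them is unique. -/
def IsOrderDelaunayTriangle (P : Finset Plane) (k : ℕ) (t : Finset Plane) : Prop :=
  ∃ C : EuclideanGeometry.Sphere Plane, (t : Set Plane) ⊆ C ∧
    (P.filter (fun p => dist p C.center < C.radius)).card ≤ k

/-- An order-`k` Delaunay triangulation of `P`: a triangulation of `P` all of whose triangles are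
order-`k` Delaunay. -/
structure IsOrderDelaunay (P : Finset Plane) (k : ℕ) (K : Geometry.SimplicialComplex ℝ Plane) :
    Prop where
  isTriangulation : IsTriangulation P K
  order_le : ∀ t ∈ K.faces, t.card = 3 → IsOrderDelaunayTriangle P k t

/-- A Delaunay triangulation of `P`: a triangulation of `P` in which the circumcircle of every
triangle has no point of `P` in its interior. -/
structure IsDelaunay (P : Finset Plane) (K : Geometry.SimplicialComplex ℝ Plane) : Prop where
  isTriangulation : IsTriangulation P K
  empty_circle : ∀ t ∈ K.faces, t.card = 3 →
    ∃ C : EuclideanGeometry.Sphere Plane, (t : Set Plane) ⊆ C ∧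
      ∀ p ∈ P, C.radius ≤ dist p C.center

/-!
The points lie in three clusters, each of at least `n / 3 > k` points, in convex position: in
counterclockwise order they are `p 0 0, p 0 1, …, p 1 0, …, p 2 0, …` (`IsThreeFan`). Cluster `c`
hugs a circle that encloses cluster `c + 1` and leaves cluster `c + 2` outside. Hence every circle
through three points of `c`, or through two points of `c` and one of `c + 2`, encloses all of `c +
1`, and no order-`k` Delaunay triangle has such vertices. This alone determines the triangulation:

* every hull edge of cluster `c` spans a triangle, whose apex must lie in `c + 1`
  (`IsThreeFan.exists_third`);
* that apex is the first point of `c + 1`, as from any other apex the triangle would cut off the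
  first hull edge of `c + 1` from its own apex, which lies in `c + 2` (`IsThreeFan.apex_eq_zero`);
* so each cluster is joined in a fan to the first point of the next one, and the only room left is
  the triangle of the three first points (`IsThreeFan.fan_or_center`).

Two order-`k` Delaunay triangulations therefore differ in at most the central triangle, which makes
one a subcomplex of the other; nested triangulations of the same set are equal
(`IsThreeFan.orderDelaunay_unique`).

The Delaunay triangulation is an order-`k` Delaunay triangulation for each `k`, and it exists for
every finite set in general position (`exists_isDelaunay`): its faces are the sets of points nearest
to some centre. Two such faces are separated by the radical axis of their circles, and a point `x`
of the hull is covered by the face that belongs to the centre `o` minimizing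
`‖x - o‖ ^ 2 - infDist o P ^ 2`.

The configuration consists of points on three short circular arcs around the corners of a triangle
(`exists_isThreeFan`). All conditions on it are strict inequalities, so it can be moved into general
position (`IsThreeFan.exists_generic`): collinearity and cocircularity are the vanishing of
polynomials, whose nonvanishing sets are open and dense.
-/

open Filter Topology

/-! ### Orientation and in-circle determinants -/

/-- Twice the signed area of the triangle `abc`; positive when `a`, `b`, `c` turn left. -/
def orient (a b c : Plane) : ℝ :=
  (b 0 - a 0) * (c 1 - a 1) - (b 1 - a 1) * (c 0 - a 0)

/-- The in-circle determinant. When `a`, `b`, `c` turn left it is positive exactly if `d` lies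
inside the circle through `a`, `b`, `c`, see `incirc_eq`. -/
def incirc (a b c d : Plane) : ℝ :=
  ((a 0 - d 0) ^ 2 + (a 1 - d 1) ^ 2) * orient d b c
    - ((b 0 - d 0) ^ 2 + (b 1 - d 1) ^ 2) * orient d a c
    + ((c 0 - d 0) ^ 2 + (c 1 - d 1) ^ 2) * orient d a b

lemma orient_rotate (a b c : Plane) : orient b c a = orient a b c := by
  unfold orient; ring

lemma orient_self_left (a b : Plane) : orient a a b = 0 := by
  unfold orient; ring

lemma orient_self_right (a b : Plane) : orient a b b = 0 := by
  unfold orient; ring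

lemma orient_self_outer (a b : Plane) : orient a b a = 0 := by
  unfold orient; ring

lemma norm_sub_sq_eq (p o : Plane) : ‖p - o‖ ^ 2 = (p 0 - o 0) ^ 2 + (p 1 - o 1) ^ 2 := by
  simp [EuclideanSpace.norm_sq_eq, Fin.sum_univ_two]

/-- The in-circle determinant in terms of the power `‖p - o‖ ^ 2 - ρ` of its four arguments
with respect to any circle. -/
lemma incirc_eq (a b c d o : Plane) (ρ : ℝ) :
    incirc a b c d = (‖a - o‖ ^ 2 - ρ) * orient d b c - (‖b - o‖ ^ 2 - ρ) * orient d a c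
      + (‖c - o‖ ^ 2 - ρ) * orient d a b - (‖d - o‖ ^ 2 - ρ) * orient a b c := by
  simp only [norm_sub_sq_eq]
  unfold incirc orient; ring

lemma orient_eq_zero_of_collinear {a b c : Plane} (h : Collinear ℝ ({a, b, c} : Set Plane)) :
    orient a b c = 0 := by
  obtain ⟨v, hv⟩ := (collinear_iff_of_mem (p₀ := a) (by simp)).1 h
  obtain ⟨r, hr⟩ := hv b (by simp)
  obtain ⟨s, hs⟩ := hv c (by simp)
  subst hr hs
  simp [orient]; ring

lemma collinear_of_orient_eq_zero {a b c : Plane} (h : orient a b c = 0) :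
    Collinear ℝ ({a, b, c} : Set Plane) := by
  by_cases hab : b = a
  · subst hab
    simpa using collinear_pair ℝ b c
  have hne : (b 0 - a 0) ^ 2 + (b 1 - a 1) ^ 2 ≠ 0 := by
    intro h0
    apply hab
    ext i
    fin_cases i
    · simp; nlinarith [sq_nonneg (b 0 - a 0), sq_nonneg (b 1 - a 1)]
    · simp; nlinarith [sq_nonneg (b 0 - a 0), sq_nonneg (b 1 - a 1)]
  rw [collinear_iff_of_mem (p₀ := a) (by simp)]
  refine ⟨b - a, ?_⟩
  rintro p (rfl | rfl | rfl)
  · exact ⟨0, by simp⟩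
  · exact ⟨1, by simp⟩
  · -- the orthogonal projection of `p - a` to `b - a`, which is `p - a` itself
    refine ⟨((p 0 - a 0) * (b 0 - a 0) + (p 1 - a 1) * (b 1 - a 1)) /
      ((b 0 - a 0) ^ 2 + (b 1 - a 1) ^ 2), ?_⟩
    unfold orient at h
    ext i
    fin_cases i
    · simp; field_simp; linear_combination (b 1 - a 1) * (-1 : ℝ) * h
    · simp; field_simp; linear_combination (b 0 - a 0) * h

lemma incirc_eq_zero_of_cospherical {a b c d : Plane}
    (h : EuclideanGeometry.Cospherical ({a, b, c, d} : Set Plane)) : incirc a b c d = 0 := by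
  obtain ⟨o, r, hr⟩ := h
  have key : ∀ p ∈ ({a, b, c, d} : Set Plane), ‖p - o‖ ^ 2 - r ^ 2 = 0 := fun p hp => by
    rw [← dist_eq_norm, hr p hp, sub_self]
  rw [incirc_eq a b c d o (r ^ 2), key a (by simp), key b (by simp), key c (by simp),
    key d (by simp)]
  ring

/-- A point with positive in-circle determinant lies inside every sphere through the first three
points. -/
lemma dist_center_lt_radius {a b c d : Plane} {C : EuclideanGeometry.Sphere Plane}
    (ha : a ∈ C) (hb : b ∈ C) (hc : c ∈ C) (habc : 0 < orient a b c) (h : 0 < incirc a b c d) :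
    dist d C.center < C.radius := by
  have key : ∀ p ∈ C, ‖p - C.center‖ ^ 2 - C.radius ^ 2 = 0 := fun p hp => by
    rw [← dist_eq_norm, EuclideanGeometry.mem_sphere.1 hp, sub_self]
  rw [incirc_eq a b c d C.center (C.radius ^ 2), key a ha, key b hb, key c hc] at h
  have hr : 0 ≤ C.radius := by
    rw [← EuclideanGeometry.mem_sphere.1 ha]; exact dist_nonneg
  have : ‖d - C.center‖ ^ 2 < C.radius ^ 2 := by nlinarith
  rw [dist_eq_norm]
  exact lt_of_pow_lt_pow_left₀ 2 hr this

/-- Two diagonals of a convex quadrilateral `abcd` meet. -/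
lemma exists_mem_segment_inter {a b c d : Plane} (h₁ : 0 < orient a b c) (h₂ : 0 < orient b c d)
    (h₃ : 0 < orient c d a) (h₄ : 0 < orient d a b) :
    ∃ x, x ∈ segment ℝ a c ∧ x ∈ segment ℝ b d := by
  have hS : 0 < orient b c d + orient d a b := by positivity
  have hS' : 0 < orient c d a + orient a b c := by positivity
  have hSS : orient b c d + orient d a b = orient c d a + orient a b c := by
    unfold orient; ring
  refine ⟨(orient b c d / (orient b c d + orient d a b)) • a +
    (orient d a b / (orient b c d + orient d a b)) • c,
    ⟨_, _, by positivity, by positivity, by field_simp, rfl⟩,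
    orient c d a / (orient c d a + orient a b c), orient a b c / (orient c d a + orient a b c),
    by positivity, by positivity, by field_simp, ?_⟩
  rw [← hSS]
  ext i
  fin_cases i
  · simp; field_simp; unfold orient; ring
  · simp; field_simp; unfold orient; ring

/-- A point of a convex hull at which a linear functional attains its minimum over the vertices is
a convex combination of the minimizing vertices. -/
lemma mem_convexHull_filter_eq {E : Type*} [AddCommGroup E] [Module ℝ E] {t : Finset E} {x : E}
    (f : E →ₗ[ℝ] ℝ) (c : ℝ) (ht : ∀ q ∈ t, c ≤ f q) (hx : x ∈ convexHull ℝ (t : Set E))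
    (hfx : f x ≤ c) : x ∈ convexHull ℝ ((t.filter fun q => f q = c : Finset E) : Set E) := by
  classical
  obtain ⟨w, hw, hw1, rfl⟩ := Finset.mem_convexHull'.1 hx
  have hsum : ∑ q ∈ t, w q * (f q - c) ≤ 0 := by
    have : ∑ q ∈ t, w q * (f q - c) = f (∑ q ∈ t, w q • q) - c := by
      simp only [mul_sub, Finset.sum_sub_distrib, map_sum, map_smul, smul_eq_mul,
        ← Finset.sum_mul, hw1, one_mul]
    linarith
  have hnn : ∀ q ∈ t, 0 ≤ w q * (f q - c) := fun q hq =>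
    mul_nonneg (hw q hq) (sub_nonneg.2 (ht q hq))
  have h0 := (Finset.sum_eq_zero_iff_of_nonneg hnn).1
    (le_antisymm hsum (Finset.sum_nonneg hnn))
  have hz : ∀ q ∈ t, f q ≠ c → w q = 0 := fun q hq hne =>
    (mul_eq_zero.1 (h0 q hq)).resolve_right (sub_ne_zero.2 hne)
  refine Finset.mem_convexHull'.2 ⟨w, fun q hq => hw q (Finset.mem_filter.1 hq).1, ?_, ?_⟩
  · rw [Finset.sum_filter_of_ne, hw1]
    exact fun q hq hne => by_contra fun h => hne (hz q hq h)
  · rw [Finset.sum_filter_of_ne]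
    exact fun q hq hne => by_contra fun h => hne (by rw [hz q hq h, zero_smul])

/-! ### The Delaunay complex of a point set in general position -/

open Classical in
/-- The points of `P` nearest to `o`, that is, the points of `P` on the largest circle with
centre `o` that has no point of `P` in its interior. -/
noncomputable def nearest (P : Finset Plane) (o : Plane) : Finset Plane :=
  P.filter fun p => ∀ q ∈ P, ‖p - o‖ ^ 2 ≤ ‖q - o‖ ^ 2

lemma mem_nearest {P : Finset Plane} {o p : Plane} :
    p ∈ nearest P o ↔ p ∈ P ∧ ∀ q ∈ P, ‖p - o‖ ^ 2 ≤ ‖q - o‖ ^ 2 := by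
  simp [nearest]

lemma nearest_subset (P : Finset Plane) (o : Plane) : nearest P o ⊆ P :=
  fun _ hp => (mem_nearest.1 hp).1

lemma norm_sq_eq_of_mem_nearest {P : Finset Plane} {o p q : Plane} (hp : p ∈ nearest P o)
    (hq : q ∈ nearest P o) : ‖p - o‖ ^ 2 = ‖q - o‖ ^ 2 :=
  le_antisymm ((mem_nearest.1 hp).2 q (mem_nearest.1 hq).1)
    ((mem_nearest.1 hq).2 p (mem_nearest.1 hp).1)

lemma nearest_nonempty {P : Finset Plane} (hP : P.Nonempty) (o : Plane) :
    (nearest P o).Nonempty := by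
  obtain ⟨p, hp, hmin⟩ := P.exists_min_image (fun p => ‖p - o‖ ^ 2) hP
  exact ⟨p, mem_nearest.2 ⟨hp, hmin⟩⟩

/-- The difference of the squared distances to two centres is an affine function. -/
lemma norm_sub_sq_sub (p o o' : Plane) :
    ‖p - o‖ ^ 2 - ‖p - o'‖ ^ 2 = 2 * inner ℝ (o' - o) p + (‖o‖ ^ 2 - ‖o'‖ ^ 2) := by
  rw [norm_sub_sq_real, norm_sub_sq_real, inner_sub_left, real_inner_comm o p,
    real_inner_comm o' p]
  ring

/-- The hulls of two sets of nearest points are separated by the radical axis of the two circles,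
which meets either hull only in points spanned by the common vertices. -/
lemma mem_convexHull_inter_nearest {P s t : Finset Plane} {o o' x : Plane}
    (hs : s ⊆ nearest P o) (ht : t ⊆ nearest P o') (hxs : x ∈ convexHull ℝ (s : Set Plane))
    (hxt : x ∈ convexHull ℝ (t : Set Plane)) :
    x ∈ convexHull ℝ (t ∩ nearest P o : Set Plane) := by
  classical
  have hsne : s.Nonempty := by
    rw [← Finset.coe_nonempty]; exact (convexHull_nonempty_iff (𝕜 := ℝ)).1 ⟨x, hxs⟩
  have htne : t.Nonempty := by
    rw [← Finset.coe_nonempty]; exact (convexHull_nonempty_iff (𝕜 := ℝ)).1 ⟨x, hxt⟩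
  obtain ⟨a, ha⟩ := hsne
  obtain ⟨b, hb⟩ := htne
  set f : Plane →ₗ[ℝ] ℝ := (innerₛₗ ℝ (o' - o)) with hf
  have hfv : ∀ p, 2 * f p = ‖p - o‖ ^ 2 - ‖p - o'‖ ^ 2 - (‖o‖ ^ 2 - ‖o'‖ ^ 2) := fun p => by
    rw [norm_sub_sq_sub]; simp [hf, inner_sub_left]
  set c : ℝ := (‖a - o‖ ^ 2 - ‖b - o'‖ ^ 2 - (‖o‖ ^ 2 - ‖o'‖ ^ 2)) / 2 with hc
  have hcs : ∀ p ∈ s, f p ≤ c := fun p hp => by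
    have h1 := norm_sq_eq_of_mem_nearest (hs hp) (hs ha)
    have h2 := (mem_nearest.1 (ht hb)).2 p (nearest_subset _ _ (hs hp))
    have h3 := hfv p
    linarith
  have hct : ∀ p ∈ t, c ≤ f p := fun p hp => by
    have h1 := norm_sq_eq_of_mem_nearest (ht hp) (ht hb)
    have h2 := (mem_nearest.1 (hs ha)).2 p (nearest_subset _ _ (ht hp))
    have h3 := hfv p
    linarith
  have hx : f x ≤ c :=
    convexHull_min (fun p hp => hcs p hp) (convex_halfSpace_le f.isLinear c) hxs
  refine convexHull_mono ?_ (mem_convexHull_filter_eq f c hct hxt hx)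
  intro q hq
  obtain ⟨hqt, hqc⟩ := Finset.mem_filter.1 (Finset.mem_coe.1 hq)
  refine ⟨hqt, Finset.mem_coe.2 (mem_nearest.2 ⟨nearest_subset _ _ (ht hqt), fun r hr => ?_⟩)⟩
  have h1 := norm_sq_eq_of_mem_nearest (ht hqt) (ht hb)
  have h2 := (mem_nearest.1 (hs ha)).2 r hr
  have h3 := hfv q
  linarith

lemma affineIndependent_of_card_le_three {P s : Finset Plane} (hP : InGeneralPosition P)
    (h3 : 3 ≤ P.card) (hs : s ⊆ P) (hcard : s.card ≤ 3) :
    AffineIndependent ℝ ((↑) : s → Plane) := by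
  classical
  obtain ⟨t, hst, htP, ht⟩ := Finset.exists_subsuperset_card_eq hs hcard h3
  obtain ⟨a, b, c, hab, hac, hbc, rfl⟩ := Finset.card_eq_three.1 ht
  have hcol := hP.1 _ htP ht
  have hind : AffineIndependent ℝ ![a, b, c] := by
    rw [affineIndependent_iff_not_collinear_set]; simpa using hcol
  have := hind.range
  have hr : Set.range ![a, b, c] = (({a, b, c} : Finset Plane) : Set Plane) := by
    ext x; simp [eq_comm, or_left_comm, or_comm]
  rw [hr] at this
  exact this.mono (Finset.coe_subset.2 hst)

lemma card_nearest_le_three {P : Finset Plane} (hP : InGeneralPosition P) (o : Plane) :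
    (nearest P o).card ≤ 3 := by
  by_contra! h
  obtain ⟨t, ht, hcard⟩ := Finset.exists_subset_card_eq (Nat.succ_le_of_lt h)
  refine hP.2 t (ht.trans (nearest_subset P o)) hcard ?_
  obtain ⟨a, ha⟩ := Finset.card_pos.1 (by omega : 0 < t.card)
  refine ⟨o, ‖a - o‖, fun p hp => ?_⟩
  rw [dist_eq_norm]
  exact (pow_left_inj₀ (norm_nonneg _) (norm_nonneg _) two_ne_zero).1
    (norm_sq_eq_of_mem_nearest (ht hp) (ht ha))

/-- The Delaunay complex: its faces are the nonempty sets of points lying on a circle without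
points of `P` in its interior. -/
def delaunayComplex (P : Finset Plane) (hP : InGeneralPosition P) (h3 : 3 ≤ P.card) :
    Geometry.SimplicialComplex ℝ Plane where
  faces := {s | s.Nonempty ∧ ∃ o, s ⊆ nearest P o}
  isRelLowerSet_faces := by
    rintro s ⟨hs, o, hso⟩
    exact ⟨hs, fun t hts ht => ⟨ht, o, Finset.Subset.trans hts hso⟩⟩
  indep := by
    rintro s ⟨-, o, hso⟩
    exact affineIndependent_of_card_le_three hP h3 (hso.trans (nearest_subset P o))
      ((Finset.card_le_card hso).trans (card_nearest_le_three hP o))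
  inter_subset_convexHull := by
    rintro s t ⟨-, o, hso⟩ ⟨-, o', hto⟩ x ⟨hxs, hxt⟩
    have hx := mem_convexHull_inter_nearest hso hto hxs hxt
    have hind := affineIndependent_of_card_le_three hP h3 (nearest_subset P o)
      (card_nearest_le_three hP o)
    classical
    rw [← Finset.coe_inter] at hx
    have hmem := Set.mem_inter hxs hx
    rw [← hind.convexHull_inter hso Finset.inter_subset_right] at hmem
    refine convexHull_mono ?_ hmem
    rintro y ⟨hys, hyt⟩
    exact ⟨hys, (Finset.mem_inter.1 hyt).1⟩

/-- The centre of an empty circle through fewer than three points can be moved, keeping these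
points on the circle, until the circle reaches a further point of `P`. -/
lemma exists_nearest_ssubset {P : Finset Plane} (hP : InGeneralPosition P) (h3 : 3 ≤ P.card)
    {o : Plane} (h : (nearest P o).card < 3) : ∃ o', nearest P o ⊂ nearest P o' := by
  classical
  obtain ⟨t, hst, htP, ht⟩ :=
    Finset.exists_subsuperset_card_eq (nearest_subset P o) h.le h3
  obtain ⟨c, hct, hcn⟩ : ∃ c ∈ t, c ∉ nearest P o := by
    by_contra! hc
    have := Finset.card_le_card (show t ⊆ nearest P o from hc)
    omega
  obtain ⟨a, ha⟩ := nearest_nonempty (Finset.card_pos.1 (by omega : 0 < P.card)) o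
  have hac : a ≠ c := fun hac => hcn (hac ▸ ha)
  obtain ⟨b, hbt⟩ : ∃ b, (t.erase c).erase a = {b} := by
    rw [← Finset.card_eq_one, Finset.card_erase_of_mem
      (Finset.mem_erase.2 ⟨hac, hst ha⟩), Finset.card_erase_of_mem hct, ht]
  have hteq : ∀ p, p ∈ t ↔ p = a ∨ p = b ∨ p = c := fun p => by
    have := Finset.ext_iff.1 hbt p
    simp only [Finset.mem_erase, Finset.mem_singleton] at this
    by_cases hpa : p = a
    · simp [hpa, hst ha]
    · by_cases hpc : p = c
      · simp [hpc, hct]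
      · simp only [hpa, hpc, false_or, or_false, ← this]; simp [hpa, hpc]
  have hor : orient a b c ≠ 0 := by
    intro h0
    refine hP.1 t htP ht ?_
    have : (t : Set Plane) = {a, b, c} := by ext p; simp [hteq]
    rw [this]; exact collinear_of_orient_eq_zero h0
  have hnear : ∀ p ∈ nearest P o, p = a ∨ p = b := fun p hp => by
    rcases (hteq p).1 (hst hp) with h | h | h
    · exact Or.inl h
    · exact Or.inr h
    · exact absurd (h ▸ hp) hcn
  -- a direction orthogonal to `b - a` pointing to the side of `c`
  obtain ⟨v, hvb, hvc⟩ : ∃ v : Plane, inner ℝ v (b - a) = 0 ∧ 0 < inner ℝ v (c - a) := by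
    refine ⟨!₂[-(b 1 - a 1) * orient a b c, (b 0 - a 0) * orient a b c], ?_, ?_⟩
    · simp [PiLp.inner_apply, Fin.sum_univ_two]; ring
    · have : 0 < orient a b c ^ 2 := by positivity
      convert this using 1
      simp only [PiLp.inner_apply, Fin.sum_univ_two]
      simp [orient]; ring
  have hmove : ∀ (τ : ℝ) (q : Plane), ‖q - (o + τ • v)‖ ^ 2 - ‖a - (o + τ • v)‖ ^ 2 =
      ‖q - o‖ ^ 2 - ‖a - o‖ ^ 2 - 2 * τ * inner ℝ v (q - a) := fun τ q => by
    have h1 := norm_sub_sq_sub q (o + τ • v) o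
    have h2 := norm_sub_sq_sub a (o + τ • v) o
    have h4 : o - (o + τ • v) = (-τ) • v := by simp
    rw [h4, real_inner_smul_left] at h1 h2
    rw [inner_sub_right]
    linarith
  -- the first point that the growing circle through `a` reaches on that side
  set S := P.filter fun r => 0 < inner ℝ v (r - a) with hS
  obtain ⟨r, hr, hmin⟩ := S.exists_min_image
    (fun r => (‖r - o‖ ^ 2 - ‖a - o‖ ^ 2) / (2 * inner ℝ v (r - a)))
    ⟨c, Finset.mem_filter.2 ⟨htP hct, hvc⟩⟩
  obtain ⟨hrP, hrv⟩ := Finset.mem_filter.1 hr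
  set τ := (‖r - o‖ ^ 2 - ‖a - o‖ ^ 2) / (2 * inner ℝ v (r - a)) with hτ
  have hna := (mem_nearest.1 ha).2
  have hτ0 : 0 ≤ τ := div_nonneg (sub_nonneg.2 (hna r hrP)) (by positivity)
  have hge : ∀ q ∈ P, ‖a - (o + τ • v)‖ ^ 2 ≤ ‖q - (o + τ • v)‖ ^ 2 := fun q hq => by
    have h1 := hmove τ q
    have h2 := hna q hq
    by_cases hqv : 0 < inner ℝ v (q - a)
    · have h4 := hmin q (Finset.mem_filter.2 ⟨hq, hqv⟩)
      rw [le_div_iff₀ (by positivity)] at h4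
      nlinarith
    · nlinarith [mul_nonneg hτ0 (sub_nonneg.2 (not_lt.1 hqv))]
  have hmem : ∀ q ∈ P, ‖q - o‖ ^ 2 - ‖a - o‖ ^ 2 - 2 * τ * inner ℝ v (q - a) = 0 →
      q ∈ nearest P (o + τ • v) := fun q hq h0 =>
    mem_nearest.2 ⟨hq, fun p hp => by have := hmove τ q; have := hge p hp; linarith⟩
  refine ⟨o + τ • v, Finset.ssubset_iff_subset_ne.2 ⟨fun q hq => ?_, fun heq => ?_⟩⟩
  · refine hmem q (nearest_subset _ _ hq) ?_
    rcases hnear q hq with rfl | rfl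
    · simp
    · rw [hvb, norm_sq_eq_of_mem_nearest hq ha]; simp
  · have hrn : r ∈ nearest P o := by
      rw [heq]
      refine hmem r hrP ?_
      rw [hτ]; field_simp; ring
    rcases hnear r hrn with rfl | rfl
    · simp at hrv
    · exact hrv.ne' hvb

lemma exists_nearest_card_eq_three {P : Finset Plane} (hP : InGeneralPosition P)
    (h3 : 3 ≤ P.card) (o : Plane) :
    ∃ o', nearest P o ⊆ nearest P o' ∧ (nearest P o').card = 3 := by
  by_cases h : (nearest P o).card < 3
  · obtain ⟨o₁, ho₁⟩ := exists_nearest_ssubset hP h3 h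
    have hlt := Finset.card_lt_card ho₁
    have hle := card_nearest_le_three hP o₁
    obtain ⟨o₂, h₂, hc₂⟩ := exists_nearest_card_eq_three hP h3 o₁
    exact ⟨o₂, ho₁.subset.trans h₂, hc₂⟩
  · exact ⟨o, subset_rfl, le_antisymm (card_nearest_le_three hP o) (not_lt.1 h)⟩
termination_by 3 - (nearest P o).card

/-- The centre minimizing `‖x - o‖ ^ 2 - infDist o P ^ 2` belongs to a Delaunay cell that contains
`x`: otherwise moving the centre away from a line separating `x` from that cell would decrease the
value. Minimizers exist since the function is coercive for `x` in the interior of the hull. -/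
lemma exists_mem_convexHull_nearest {P : Finset Plane} (hP : P.Nonempty) {x : Plane}
    (hx : x ∈ interior (convexHull ℝ (P : Set Plane))) :
    ∃ o, x ∈ convexHull ℝ (nearest P o : Set Plane) := by
  have hnear : ∀ o, ∀ p ∈ nearest P o, Metric.infDist o (P : Set Plane) = ‖p - o‖ := by
    intro o p hp
    apply le_antisymm
    · rw [← dist_eq_norm, dist_comm]
      exact Metric.infDist_le_dist_of_mem (nearest_subset _ _ hp)
    · rw [Metric.le_infDist (Finset.coe_nonempty.2 hP)]
      intro q hq
      rw [dist_comm, dist_eq_norm]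
      exact (pow_le_pow_iff_left₀ (norm_nonneg _) (norm_nonneg _) two_ne_zero).1
        ((mem_nearest.1 hp).2 q hq)
  set F : Plane → ℝ := fun o => ‖x - o‖ ^ 2 - Metric.infDist o (P : Set Plane) ^ 2 with hF
  have hFge : ∀ o, ∀ p ∈ P, ‖x - o‖ ^ 2 - ‖p - o‖ ^ 2 ≤ F o := fun o p hp => by
    have h1 : Metric.infDist o (P : Set Plane) ≤ ‖p - o‖ := by
      rw [← dist_eq_norm, dist_comm]
      exact Metric.infDist_le_dist_of_mem hp
    have h2 := pow_le_pow_left₀ Metric.infDist_nonneg h1 2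
    simp only [hF]; linarith
  have hexp : ∀ o p : Plane, ‖x - o‖ ^ 2 - ‖p - o‖ ^ 2 =
      ‖x‖ ^ 2 - ‖p‖ ^ 2 + 2 * inner ℝ o (p - x) := fun o p => by
    rw [norm_sub_sq_real, norm_sub_sq_real, inner_sub_right, real_inner_comm o x,
      real_inner_comm o p]
    ring
  obtain ⟨r, hr, hball⟩ := Metric.isOpen_iff.1 isOpen_interior x hx
  obtain ⟨pm, hpm, hmax⟩ := P.exists_max_image (fun p => ‖p‖ ^ 2) hP
  -- some point of `P` lies at least `r / 2` further than `x` in the direction of `o`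
  have hcoer : ∀ o, r * ‖o‖ + (‖x‖ ^ 2 - ‖pm‖ ^ 2) ≤ F o := fun o => by
    obtain ⟨p, hp, hpo⟩ : ∃ p ∈ P, r / 2 * ‖o‖ ≤ inner ℝ o (p - x) := by
      by_contra! hcon
      rcases eq_or_ne o 0 with rfl | ho
      · obtain ⟨p, hp⟩ := hP
        have := hcon p hp
        simp at this
      have ho' : 0 < ‖o‖ := norm_pos_iff.2 ho
      have hy : x + (r / 2 / ‖o‖) • o ∈ convexHull ℝ (P : Set Plane) := by
        refine interior_subset (hball ?_)
        rw [Metric.mem_ball, dist_eq_norm, add_sub_cancel_left, norm_smul, Real.norm_eq_abs,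
          abs_of_pos (by positivity), div_mul_cancel₀ _ ho'.ne']
        linarith
      have hlin : ∀ y ∈ convexHull ℝ (P : Set Plane),
          innerₛₗ ℝ o y < r / 2 * ‖o‖ + inner ℝ o x := fun y hy => by
        refine convexHull_min (fun p hp => ?_)
          (convex_halfSpace_lt (innerₛₗ ℝ o).isLinear (r / 2 * ‖o‖ + inner ℝ o x)) hy
        have := hcon p hp
        rw [inner_sub_right] at this
        simp only [Set.mem_ofPred_eq, innerₛₗ_apply_apply]
        linarith
      have := hlin _ hy
      rw [innerₛₗ_apply_apply, inner_add_right, real_inner_smul_right,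
        real_inner_self_eq_norm_sq] at this
      have h5 : r / 2 / ‖o‖ * ‖o‖ ^ 2 = r / 2 * ‖o‖ := by field_simp
      linarith
    have h1 := hFge o p hp
    rw [hexp] at h1
    have h2 := hmax p hp
    linarith
  have hFcont : Continuous F := by
    have : Continuous fun o => Metric.infDist o (P : Set Plane) := Metric.continuous_infDist_pt _
    fun_prop
  have hFtop : Filter.Tendsto F (Filter.cocompact Plane) Filter.atTop := by
    refine Filter.tendsto_atTop_mono hcoer ?_
    exact Filter.tendsto_atTop_add_const_right _ _
      ((tendsto_norm_cocompact_atTop).const_mul_atTop hr)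
  obtain ⟨o, ho⟩ := hFcont.exists_forall_le hFtop
  refine ⟨o, by_contra fun hxn => ?_⟩
  obtain ⟨f, u, hfx, hfT⟩ := geometric_hahn_banach_point_closed (convex_convexHull ℝ _)
    ((nearest P o).finite_toSet.isCompact_convexHull ℝ).isClosed hxn
  set v : Plane := (InnerProductSpace.toDual ℝ Plane).symm f with hv
  have hfv : ∀ y, inner ℝ v y = f y := fun y => by simp [hv]
  -- moving the centre by `-ε • v` gets it closer to `x` relative to the nearest points, while the
  -- other points do not matter for small `ε`
  have hsmall : ∀ p ∈ P, ∀ᶠ ε : ℝ in 𝓝[>] 0,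
      ‖x - (o - ε • v)‖ ^ 2 - ‖p - (o - ε • v)‖ ^ 2 < F o := fun p hp => by
    have hval : ∀ ε : ℝ, ‖x - (o - ε • v)‖ ^ 2 - ‖p - (o - ε • v)‖ ^ 2 =
        ‖x - o‖ ^ 2 - ‖p - o‖ ^ 2 + 2 * ε * (f x - f p) := fun ε => by
      rw [hexp, hexp, inner_sub_left, real_inner_smul_left, hfv, map_sub]; ring
    by_cases hpn : p ∈ nearest P o
    · have h1 : f x < f p := hfx.trans (hfT p (subset_convexHull ℝ _ hpn))
      filter_upwards [self_mem_nhdsWithin] with ε hε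
      rw [hval]
      have := hFge o p hp
      nlinarith [Set.mem_Ioi.1 hε]
    · have hlt : ‖x - o‖ ^ 2 - ‖p - o‖ ^ 2 < F o := by
        obtain ⟨q, hq⟩ := nearest_nonempty hP o
        have h1 : F o = ‖x - o‖ ^ 2 - ‖q - o‖ ^ 2 := by simp only [hF, hnear o q hq]
        have h2 : ‖q - o‖ ^ 2 < ‖p - o‖ ^ 2 := by
          by_contra! h
          exact hpn (mem_nearest.2 ⟨hp, fun s hs => h.trans ((mem_nearest.1 hq).2 s hs)⟩)
        linarith
      have hc : ContinuousAt (fun ε : ℝ =>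
          ‖x - o‖ ^ 2 - ‖p - o‖ ^ 2 + 2 * ε * (f x - f p)) 0 := by fun_prop
      have := (hc.eventually_lt_const (u := F o) (by simpa using hlt)).filter_mono
        (nhdsWithin_le_nhds (s := Set.Ioi 0))
      filter_upwards [this] with ε hε
      rw [hval]; exact hε
  obtain ⟨ε, hε⟩ := ((Filter.eventually_all_finset P).2 hsmall).exists
  obtain ⟨q, hq⟩ := nearest_nonempty hP (o - ε • v)
  have h1 : F (o - ε • v) = ‖x - (o - ε • v)‖ ^ 2 - ‖q - (o - ε • v)‖ ^ 2 := by
    simp only [hF, hnear _ q hq]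
  have h2 := hε q (nearest_subset _ _ hq)
  have h3 := ho (o - ε • v)
  linarith

lemma interior_convexHull_nonempty {P : Finset Plane} (hP : InGeneralPosition P)
    (h3 : 3 ≤ P.card) : (interior (convexHull ℝ (P : Set Plane))).Nonempty := by
  obtain ⟨t, htP, ht⟩ := Finset.exists_subset_card_eq h3
  have hind := affineIndependent_of_card_le_three hP h3 htP ht.le
  refine Set.Nonempty.mono (interior_mono (convexHull_mono (Finset.coe_subset.2 htP))) ?_
  rw [interior_convexHull_nonempty_iff_affineSpan_eq_top]
  have := hind.affineSpan_eq_top_iff_card_eq_finrank_add_one.2 (by simp [ht])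
  simpa using this

lemma isClosed_space {P : Finset Plane} {K : Geometry.SimplicialComplex ℝ Plane}
    (hK : ∀ s ∈ K.faces, s ⊆ P) : IsClosed K.space := by
  have hfin : K.faces.Finite :=
    (P.powerset.finite_toSet).subset fun s hs => by simpa using hK s hs
  exact hfin.isClosed_biUnion fun s _ => (s.finite_toSet.isCompact_convexHull ℝ).isClosed

/-- A finite set in general position has a Delaunay triangulation. -/
theorem exists_isDelaunay {P : Finset Plane} (hP : InGeneralPosition P) (h3 : 3 ≤ P.card) :
    ∃ D : Geometry.SimplicialComplex ℝ Plane, IsDelaunay P D := by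
  have hPne : P.Nonempty := Finset.card_pos.1 (by omega)
  refine ⟨delaunayComplex P hP h3, ⟨?_, ?_, ?_⟩, ?_⟩
  · ext p
    constructor
    · rintro ⟨-, o, hpo⟩
      exact nearest_subset _ _ (hpo (Finset.mem_singleton_self p))
    · intro hp
      refine ⟨Finset.singleton_nonempty p, p, Finset.singleton_subset_iff.2 ?_⟩
      exact mem_nearest.2 ⟨hp, fun q _ => by simp⟩
  · apply Set.Subset.antisymm
    · refine Set.iUnion₂_subset ?_
      rintro s ⟨-, o, hso⟩
      exact convexHull_mono (Finset.coe_subset.2 (hso.trans (nearest_subset _ _)))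
    · have hint : interior (convexHull ℝ (P : Set Plane)) ⊆ (delaunayComplex P hP h3).space := by
        intro x hx
        obtain ⟨o, ho⟩ := exists_mem_convexHull_nearest hPne hx
        exact Geometry.SimplicialComplex.mem_space_iff.2
          ⟨nearest P o, ⟨nearest_nonempty hPne o, o, subset_rfl⟩, ho⟩
      have hcl := closure_minimal hint (isClosed_space (P := P) (by
        rintro s ⟨-, o, hso⟩
        exact hso.trans (nearest_subset _ _)))
      rw [(convex_convexHull ℝ _).closure_interior_eq_closure_of_nonempty_interior
        (interior_convexHull_nonempty hP h3)] at hcl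
      exact subset_closure.trans hcl
  · rintro s ⟨-, o, hso⟩
    obtain ⟨o', h₁, h₂⟩ := exists_nearest_card_eq_three hP h3 o
    exact ⟨nearest P o', ⟨nearest_nonempty hPne o', o', subset_rfl⟩, hso.trans h₁, h₂⟩
  · rintro t ⟨⟨a, ha⟩, o, hto⟩ -
    have key : ∀ p q : Plane, ‖p - o‖ ^ 2 ≤ ‖q - o‖ ^ 2 → dist p o ≤ dist q o := fun p q h => by
      rw [dist_eq_norm, dist_eq_norm]
      exact (pow_le_pow_iff_left₀ (norm_nonneg _) (norm_nonneg _) two_ne_zero).1 h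
    refine ⟨⟨o, dist a o⟩, fun p hp => ?_, fun p hp => ?_⟩
    · exact le_antisymm (key p a (norm_sq_eq_of_mem_nearest (hto hp) (hto ha)).le)
        (key a p (norm_sq_eq_of_mem_nearest (hto ha) (hto hp)).le)
    · exact key a p ((mem_nearest.1 (hto ha)).2 p hp)

/-! ### Comparing triangulations -/

/-- The affine function `orient a b` up to a constant, as a linear functional. -/
noncomputable def orientLin (a b : Plane) : Plane →ₗ[ℝ] ℝ :=
  (b 0 - a 0) • (EuclideanSpace.proj (1 : Fin 2) : Plane →L[ℝ] ℝ).toLinearMap -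
    (b 1 - a 1) • (EuclideanSpace.proj (0 : Fin 2) : Plane →L[ℝ] ℝ).toLinearMap

lemma orient_eq_orientLin (a b q : Plane) : orient a b q = orientLin a b q - orientLin a b a := by
  simp [orientLin, orient]; ring

/-- In a simplicial complex no two edges cross. -/
lemma false_of_crossing {K : Geometry.SimplicialComplex ℝ Plane} {s t : Finset Plane}
    {a b c d : Plane} (hs : s ∈ K.faces) (ha : a ∈ s) (hc : c ∈ s) (ht : t ∈ K.faces) (hb : b ∈ t)
    (hd : d ∈ t) (h₁ : 0 < orient a b c) (h₂ : 0 < orient b c d) (h₃ : 0 < orient c d a)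
    (h₄ : 0 < orient d a b) : False := by
  classical
  have hac : ({a, c} : Finset Plane) ∈ K.faces :=
    K.down_closed hs (by simp [Finset.insert_subset_iff, ha, hc]) (by simp)
  have hbd : ({b, d} : Finset Plane) ∈ K.faces :=
    K.down_closed ht (by simp [Finset.insert_subset_iff, hb, hd]) (by simp)
  obtain ⟨x, hx₁, hx₂⟩ := exists_mem_segment_inter h₁ h₂ h₃ h₄
  rw [← convexHull_pair] at hx₁ hx₂
  have hx := K.inter_subset_convexHull hac hbd ⟨by simpa using hx₁, by simpa using hx₂⟩
  obtain ⟨y, hy₁, hy₂⟩ := (convexHull_nonempty_iff (𝕜 := ℝ)).1 ⟨x, hx⟩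
  simp only [Finset.coe_insert, Finset.coe_singleton, Set.mem_insert_iff,
    Set.mem_singleton_iff] at hy₁ hy₂
  rcases hy₁ with rfl | rfl <;> rcases hy₂ with rfl | rfl
  · simp [orient_self_left] at h₁
  · simp [orient_self_left] at h₄
  · simp [orient_self_right] at h₁
  · simp [orient_self_right] at h₂

lemma IsTriangulation.subset {P : Finset Plane} {K : Geometry.SimplicialComplex ℝ Plane}
    (hK : IsTriangulation P K) {s : Finset Plane} (hs : s ∈ K.faces) : s ⊆ P := by
  intro x hx
  have : x ∈ K.vertices :=
    K.down_closed hs (Finset.singleton_subset_iff.2 hx) (Finset.singleton_nonempty x)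
  rw [hK.vertices_eq] at this
  exact this

/-- The centroid of affinely independent points does not lie in the hull of a proper subset. -/
lemma AffineIndependent.subset_of_centroid_mem {s t : Finset Plane}
    (ht : AffineIndependent ℝ ((↑) : t → Plane)) (htne : t.Nonempty) (hst : s ⊆ t)
    (h : ∑ v ∈ t, (t.card : ℝ)⁻¹ • v ∈ convexHull ℝ (s : Set Plane)) : t ⊆ s := by
  classical
  obtain ⟨w, -, hw1, hw2⟩ := Finset.mem_convexHull'.1 h
  have hc : (t.card : ℝ) ≠ 0 := by exact_mod_cast htne.card_pos.ne'
  have h0 := ht.eq_zero_of_sum_eq_zero_subtype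
    (w := fun v => (t.card : ℝ)⁻¹ - if v ∈ s then w v else 0)
    (by
      rw [Finset.sum_sub_distrib, ← Finset.sum_filter, Finset.filter_mem_eq_inter,
        Finset.inter_eq_right.2 hst, hw1]
      simp [hc])
    (by
      simp only [sub_smul, ite_smul, zero_smul, Finset.sum_sub_distrib, ← Finset.sum_filter,
        Finset.filter_mem_eq_inter, Finset.inter_eq_right.2 hst, hw2, sub_self])
  intro v hv
  by_contra hvs
  have := h0 v hv
  simp [hvs, hc] at this

/-- Nested triangulations of the same set agree: a further triangle of the larger one would cover
its own centroid, which some face of the smaller one covers already. -/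
lemma IsTriangulation.eq_of_faces_subset {P : Finset Plane}
    {K D : Geometry.SimplicialComplex ℝ Plane} (hK : IsTriangulation P K)
    (hD : IsTriangulation P D) (h : K.faces ⊆ D.faces) : K = D := by
  classical
  have hfaces : K.faces = D.faces := by
    refine Set.Subset.antisymm h fun d hd => ?_
    have hne := D.nonempty_of_mem_faces hd
    have hc : (d.card : ℝ) ≠ 0 := by exact_mod_cast hne.card_pos.ne'
    have hx : ∑ v ∈ d, (d.card : ℝ)⁻¹ • v ∈ convexHull ℝ (d : Set Plane) :=
      Finset.mem_convexHull'.2 ⟨fun _ => (d.card : ℝ)⁻¹, fun _ _ => by positivity,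
        by simp [hc], rfl⟩
    have hxK := D.convexHull_subset_space hd hx
    rw [hD.space_eq, ← hK.space_eq] at hxK
    obtain ⟨s, hs, hxs⟩ := Geometry.SimplicialComplex.mem_space_iff.1 hxK
    have hxi := D.inter_subset_convexHull (h hs) hd ⟨hxs, hx⟩
    rw [← Finset.coe_inter] at hxi
    have := (D.indep hd).subset_of_centroid_mem hne Finset.inter_subset_right hxi
    exact K.down_closed hs (this.trans Finset.inter_subset_left) hne
  ext1
  exact hfaces

lemma IsTriangulation.eq_of_triangles {P : Finset Plane}
    {K D : Geometry.SimplicialComplex ℝ Plane} (hK : IsTriangulation P K)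
    (hD : IsTriangulation P D) (h : ∀ t ∈ K.faces, t.card = 3 → t ∈ D.faces) : K = D := by
  refine hK.eq_of_faces_subset hD fun s hs => ?_
  obtain ⟨t, ht, hst, hcard⟩ := hK.face_of_triangle s hs
  exact D.down_closed (h t ht hcard) hst (K.nonempty_of_mem_faces hs)

/-- If all other points of `P` lie to the left of the directed line `ab`, then `ab` is an edge of
some triangle of every triangulation of `P`. -/
lemma IsTriangulation.exists_triangle_of_hull_edge {P : Finset Plane}
    {K : Geometry.SimplicialComplex ℝ Plane} (hK : IsTriangulation P K) {a b : Plane}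
    (ha : a ∈ P) (hb : b ∈ P) (hab : a ≠ b) (h : ∀ q ∈ P, q = a ∨ q = b ∨ 0 < orient a b q) :
    ∃ t ∈ K.faces, t.card = 3 ∧ a ∈ t ∧ b ∈ t := by
  classical
  -- the face covering the midpoint of `ab` must have both `a` and `b` among its vertices
  have hmid : midpoint ℝ a b ∈ K.space := by
    rw [hK.space_eq]
    exact (convex_convexHull ℝ _).midpoint_mem (subset_convexHull ℝ _ ha)
      (subset_convexHull ℝ _ hb)
  obtain ⟨r, hr, hxr⟩ := Geometry.SimplicialComplex.mem_space_iff.1 hmid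
  have hge : ∀ q ∈ r, orientLin a b a ≤ orientLin a b q := fun q hq => by
    have h1 := orient_eq_orientLin a b q
    rcases h q (hK.subset hr hq) with rfl | rfl | h2
    · exact le_rfl
    · rw [orient_self_right] at h1; linarith
    · linarith
  have hfmid : orientLin a b (midpoint ℝ a b) ≤ orientLin a b a := by
    have h1 := orient_eq_orientLin a b (midpoint ℝ a b)
    have h2 : orient a b (midpoint ℝ a b) = 0 := by
      simp [orient, midpoint_eq_smul_add]; ring
    linarith
  have hx := mem_convexHull_filter_eq (orientLin a b) _ hge hxr hfmid
  have honly : ∀ q ∈ r.filter (fun q => orientLin a b q = orientLin a b a), q = a ∨ q = b := by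
    intro q hq
    obtain ⟨hqr, hq0⟩ := Finset.mem_filter.1 hq
    rcases h q (hK.subset hr hqr) with h | h | h
    · exact Or.inl h
    · exact Or.inr h
    · rw [orient_eq_orientLin, hq0, sub_self] at h
      exact absurd h (lt_irrefl _)
  have har : a ∈ r := by
    by_contra har
    have hsub : ((r.filter fun q => orientLin a b q = orientLin a b a : Finset Plane) :
        Set Plane) ⊆ {b} := fun q hq => (honly q hq).resolve_left fun hqa =>
      har (hqa ▸ (Finset.mem_filter.1 hq).1)
    have := convexHull_mono hsub hx
    rw [convexHull_singleton, Set.mem_singleton_iff, midpoint_eq_right_iff] at this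
    exact hab this
  have hbr : b ∈ r := by
    by_contra hbr
    have hsub : ((r.filter fun q => orientLin a b q = orientLin a b a : Finset Plane) :
        Set Plane) ⊆ {a} := fun q hq => (honly q hq).resolve_right fun hqb =>
      hbr (hqb ▸ (Finset.mem_filter.1 hq).1)
    have := convexHull_mono hsub hx
    rw [convexHull_singleton, Set.mem_singleton_iff, midpoint_eq_left_iff] at this
    exact hab this
  obtain ⟨t, ht, hrt, hcard⟩ := hK.face_of_triangle r hr
  exact ⟨t, ht, hcard, hrt har, hrt hbr⟩

/-! ### Three clusters in convex position -/

/-- Three clusters of points in convex position: in counterclockwise order the points are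
`p 0 0, p 0 1, …, p 1 0, p 1 1, …, p 2 0, p 2 1, …`, with `N c` points `p c s`, `s < N c`, in
cluster `c`. Circles through three points of a cluster `c`, or through two points of `c` and one
point of the cluster `c + 2`, enclose the whole cluster `c + 1`. -/
structure IsThreeFan (N : Fin 3 → ℕ) (p : Fin 3 → ℕ → Plane) : Prop where
  same : ∀ c s t u, s < t → t < u → u < N c → 0 < orient (p c s) (p c t) (p c u)
  chord : ∀ c c' s t u, c' ≠ c → s < t → t < N c → u < N c' →
    0 < orient (p c s) (p c t) (p c' u)
  mixed : ∀ c s t u, s < N c → t < N (c + 1) → u < N (c + 2) →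
    0 < orient (p c s) (p (c + 1) t) (p (c + 2) u)
  incirc_same : ∀ c s t u v, s < t → t < u → u < N c → v < N (c + 1) →
    0 < incirc (p c s) (p c t) (p c u) (p (c + 1) v)
  incirc_chord : ∀ c s t u v, s < t → t < N c → u < N (c + 2) → v < N (c + 1) →
    0 < incirc (p c s) (p c t) (p (c + 2) u) (p (c + 1) v)

open Classical in
/-- The set of the points `p c s` with `s < N c`. -/
noncomputable def clusterPoints (N : Fin 3 → ℕ) (p : Fin 3 → ℕ → Plane) : Finset Plane :=
  Finset.univ.biUnion fun c => (Finset.range (N c)).image (p c)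

lemma mem_clusterPoints {N : Fin 3 → ℕ} {p : Fin 3 → ℕ → Plane} {x : Plane} :
    x ∈ clusterPoints N p ↔ ∃ c s, s < N c ∧ p c s = x := by
  simp [clusterPoints]

lemma fin_three_cases (c d : Fin 3) : d = c ∨ d = c + 1 ∨ d = c + 2 := by
  revert c d; decide

lemma fin_three_add_one_ne (c : Fin 3) : c + 1 ≠ c := by
  revert c; decide

lemma fin_three_add_two_ne (c : Fin 3) : c + 2 ≠ c := by
  revert c; decide

lemma fin_three_add_two_ne_add_one (c : Fin 3) : c + 2 ≠ c + 1 := by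
  revert c; decide

lemma fin_three_add_one_add_one (c : Fin 3) : c + 1 + 1 = c + 2 := by
  revert c; decide

section ThreeFan

variable {N : Fin 3 → ℕ} {p : Fin 3 → ℕ → Plane}

lemma IsThreeFan.ne_of_lt (h : IsThreeFan N p) (hN : ∀ c, 2 ≤ N c) {c : Fin 3} {s t : ℕ}
    (hst : s < t) (ht : t < N c) : p c s ≠ p c t := by
  intro heq
  have := h.chord c (c + 1) s t 0 (fin_three_add_one_ne c) hst ht
    (by have := hN (c + 1); omega)
  rw [heq, orient_self_left] at this
  exact lt_irrefl _ this

lemma IsThreeFan.ne_of_ne (h : IsThreeFan N p) (hN : ∀ c, 2 ≤ N c) {c d : Fin 3} {s t : ℕ}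
    (hcd : c ≠ d) (hs : s < N c) (ht : t < N d) : p c s ≠ p d t := by
  intro heq
  have h2 := hN c
  rcases Nat.eq_zero_or_pos s with rfl | hs0
  · have := h.chord c d 0 1 t hcd.symm one_pos (by omega) ht
    rw [heq, orient_self_outer] at this
    exact lt_irrefl _ this
  · have := h.chord c d 0 s t hcd.symm hs0 hs ht
    rw [heq, orient_self_right] at this
    exact lt_irrefl _ this

lemma IsThreeFan.injOn (h : IsThreeFan N p) (hN : ∀ c, 2 ≤ N c) (c : Fin 3) :
    Set.InjOn (p c) (Finset.range (N c)) := by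
  intro s hs t ht heq
  simp only [Finset.coe_range, Set.mem_Iio] at hs ht
  rcases lt_trichotomy s t with hst | hst | hst
  · exact absurd heq (h.ne_of_lt hN hst ht)
  · exact hst
  · exact absurd heq.symm (h.ne_of_lt hN hst hs)

lemma IsThreeFan.card_clusterPoints (h : IsThreeFan N p) (hN : ∀ c, 2 ≤ N c) :
    (clusterPoints N p).card = N 0 + N 1 + N 2 := by
  classical
  unfold clusterPoints
  rw [Finset.card_biUnion]
  · simp only [Finset.card_image_of_injOn (h.injOn hN _), Finset.card_range,
      Fin.sum_univ_three]
  · intro c _ d _ hcd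
    refine Finset.disjoint_left.2 ?_
    intro x hx hx'
    obtain ⟨s, hs, rfl⟩ := Finset.mem_image.1 hx
    obtain ⟨t, ht, heq⟩ := Finset.mem_image.1 hx'
    exact h.ne_of_ne hN hcd (Finset.mem_range.1 hs) (Finset.mem_range.1 ht) heq.symm

variable {k : ℕ} {K : Geometry.SimplicialComplex ℝ Plane}

/-- A triangle whose circumcircle encloses a whole cluster does not occur. -/
lemma IsThreeFan.false_of_incirc (h : IsThreeFan N p) (hN : ∀ c, 2 ≤ N c) (hk : ∀ c, k < N c)
    (hK : IsOrderDelaunay (clusterPoints N p) k K) {t : Finset Plane} (ht : t ∈ K.faces)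
    (hcard : t.card = 3) {a b d : Plane} (ha : a ∈ t) (hb : b ∈ t) (hd : d ∈ t)
    (hor : 0 < orient a b d) (c : Fin 3) (hin : ∀ v < N c, 0 < incirc a b d (p c v)) : False := by
  classical
  obtain ⟨C, htC, hle⟩ := hK.order_le t ht hcard
  have hsub : (Finset.range (N c)).image (p c) ⊆
      (clusterPoints N p).filter fun q => dist q C.center < C.radius := by
    intro x hx
    obtain ⟨v, hv, rfl⟩ := Finset.mem_image.1 hx
    rw [Finset.mem_range] at hv
    exact Finset.mem_filter.2 ⟨mem_clusterPoints.2 ⟨c, v, hv, rfl⟩,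
      dist_center_lt_radius (htC ha) (htC hb) (htC hd) hor (hin v hv)⟩
  have h1 := Finset.card_le_card hsub
  rw [Finset.card_image_of_injOn (h.injOn hN c), Finset.card_range] at h1
  have h2 := hk c
  have h3 : ((clusterPoints N p).filter fun q => dist q C.center < C.radius).card ≤ k := by
    convert hle
  omega

/-- The third vertex of a triangle with two vertices in a cluster lies in the next cluster. -/
lemma IsThreeFan.exists_third (h : IsThreeFan N p) (hN : ∀ c, 2 ≤ N c) (hk : ∀ c, k < N c)
    (hK : IsOrderDelaunay (clusterPoints N p) k K) {t : Finset Plane} (ht : t ∈ K.faces)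
    (hcard : t.card = 3) {c : Fin 3} {i j : ℕ} (hij : i < j) (hj : j < N c) (hi' : p c i ∈ t)
    (hj' : p c j ∈ t) : ∃ l < N (c + 1), p (c + 1) l ∈ t := by
  classical
  obtain ⟨w, hw⟩ : ∃ w, w ∈ (t.erase (p c i)).erase (p c j) := by
    rw [← Finset.Nonempty, ← Finset.card_pos, Finset.card_erase_of_mem, Finset.card_erase_of_mem hi']
    · omega
    · exact Finset.mem_erase.2 ⟨(h.ne_of_lt hN hij hj).symm, hj'⟩
  simp only [Finset.mem_erase] at hw
  obtain ⟨hwj, hwi, hwt⟩ := hw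
  obtain ⟨d, u, hu, rfl⟩ := mem_clusterPoints.1 (hK.isTriangulation.subset ht hwt)
  rcases fin_three_cases c d with rfl | rfl | rfl
  · exfalso
    have hui : u ≠ i := fun e => hwi (by rw [e])
    have huj : u ≠ j := fun e => hwj (by rw [e])
    rcases lt_or_gt_of_ne hui with hlt | hgt
    · exact h.false_of_incirc hN hk hK ht hcard hwt hi' hj' (h.same d u i j hlt hij hj) (d + 1)
        fun v hv => h.incirc_same d u i j v hlt hij hj hv
    · rcases lt_or_gt_of_ne huj with hlt' | hgt'
      · exact h.false_of_incirc hN hk hK ht hcard hi' hwt hj' (h.same d i u j hgt hlt' hj) (d + 1)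
          fun v hv => h.incirc_same d i u j v hgt hlt' hj hv
      · exact h.false_of_incirc hN hk hK ht hcard hi' hj' hwt (h.same d i j u hij hgt' hu) (d + 1)
          fun v hv => h.incirc_same d i j u v hij hgt' hu hv
  · exact ⟨u, hu, hwt⟩
  · exfalso
    exact h.false_of_incirc hN hk hK ht hcard hi' hj' hwt
      (h.chord c (c + 2) i j u (fin_three_add_two_ne c) hij hj hu) (c + 1)
      fun v hv => h.incirc_chord c i j u v hij hj hu hv

lemma IsThreeFan.hull_edge (h : IsThreeFan N p) {c : Fin 3} {s : ℕ} (hs : s + 1 < N c) :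
    ∀ q ∈ clusterPoints N p,
      q = p c s ∨ q = p c (s + 1) ∨ 0 < orient (p c s) (p c (s + 1)) q := by
  intro q hq
  obtain ⟨d, u, hu, rfl⟩ := mem_clusterPoints.1 hq
  by_cases hdc : d = c
  · subst hdc
    rcases lt_trichotomy u s with hlt | rfl | hgt
    · right; right
      rw [orient_rotate]
      exact h.same d u s (s + 1) hlt (by omega) hs
    · exact Or.inl rfl
    · rcases Nat.eq_or_lt_of_le hgt with heq | hlt
      · right; left; rw [← heq]
      · right; right
        exact h.same d s (s + 1) u (by omega) (by omega) hu
  · right; right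
    exact h.chord c d s (s + 1) u hdc (by omega) hs hu

lemma IsThreeFan.exists_hull_triangle (h : IsThreeFan N p) (hN : ∀ c, 2 ≤ N c)
    (hk : ∀ c, k < N c) (hK : IsOrderDelaunay (clusterPoints N p) k K) {c : Fin 3} {s : ℕ}
    (hs : s + 1 < N c) : ∃ t ∈ K.faces, t.card = 3 ∧ p c s ∈ t ∧ p c (s + 1) ∈ t ∧
      ∃ l < N (c + 1), p (c + 1) l ∈ t := by
  obtain ⟨t, ht, hcard, h1, h2⟩ := hK.isTriangulation.exists_triangle_of_hull_edge
    (mem_clusterPoints.2 ⟨c, s, by omega, rfl⟩) (mem_clusterPoints.2 ⟨c, s + 1, hs, rfl⟩)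
    (h.ne_of_lt hN (Nat.lt_succ_self s) hs) (h.hull_edge hs)
  exact ⟨t, ht, hcard, h1, h2, h.exists_third hN hk hK ht hcard (Nat.lt_succ_self s) hs h1 h2⟩

/-- An edge from cluster `c` to cluster `c + 1` ends in the first point of `c + 1`: otherwise it
would separate the first hull edge of `c + 1` from the cluster `c + 2`, which contains the apex of
the triangle on that hull edge. -/
lemma IsThreeFan.apex_eq_zero (h : IsThreeFan N p) (hN : ∀ c, 2 ≤ N c) (hk : ∀ c, k < N c)
    (hK : IsOrderDelaunay (clusterPoints N p) k K) {t : Finset Plane} (ht : t ∈ K.faces)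
    {c : Fin 3} {j l : ℕ} (hj : j < N c) (hl : l < N (c + 1)) (hj' : p c j ∈ t)
    (hl' : p (c + 1) l ∈ t) : l = 0 := by
  by_contra hl0
  obtain ⟨r, hr, -, hr0, -, q, hq, hrq⟩ := h.exists_hull_triangle hN hk hK (c := c + 1) (s := 0)
    (by have := hN (c + 1); omega)
  rw [fin_three_add_one_add_one] at hq hrq
  refine false_of_crossing ht hj' hl' hr hr0 hrq ?_ ?_ ?_ ?_
  · rw [← orient_rotate]
    exact h.chord (c + 1) c 0 l j (fin_three_add_one_ne c).symm (by omega) hl hj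
  · exact h.chord (c + 1) (c + 2) 0 l q (fin_three_add_two_ne_add_one c) (by omega) hl hq
  · rw [orient_rotate]
    exact h.mixed c j l q hj hl hq
  · rw [← orient_rotate]
    exact h.mixed c j 0 q hj (by omega) hq

/-- Every hull edge `p c s`, `p c (s + 1)` spans a triangle with the first point of the next
cluster. -/
lemma IsThreeFan.exists_fan_triangle (h : IsThreeFan N p) (hN : ∀ c, 2 ≤ N c)
    (hk : ∀ c, k < N c) (hK : IsOrderDelaunay (clusterPoints N p) k K) {c : Fin 3} {s : ℕ}
    (hs : s + 1 < N c) :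
    ∃ t ∈ K.faces, t.card = 3 ∧ p c s ∈ t ∧ p c (s + 1) ∈ t ∧ p (c + 1) 0 ∈ t := by
  obtain ⟨t, ht, hcard, h1, h2, l, hl, h3⟩ := h.exists_hull_triangle hN hk hK hs
  obtain rfl := h.apex_eq_zero hN hk hK ht (by omega : s < N c) hl h1 h3
  exact ⟨t, ht, hcard, h1, h2, h3⟩

lemma IsThreeFan.succ_eq (h : IsThreeFan N p) (hN : ∀ c, 2 ≤ N c) (hk : ∀ c, k < N c)
    (hK : IsOrderDelaunay (clusterPoints N p) k K) {t : Finset Plane} (ht : t ∈ K.faces)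
    {c : Fin 3} {i j : ℕ} (hij : i < j) (hj : j < N c) (hi' : p c i ∈ t) (hj' : p c j ∈ t) :
    j = i + 1 := by
  by_contra hne
  obtain ⟨r, hr, -, -, hr1, hr0⟩ := h.exists_fan_triangle hN hk hK (by omega : i + 1 < N c)
  have h0 : 0 < N (c + 1) := by have := hN (c + 1); omega
  have hc := fin_three_add_one_ne c
  refine false_of_crossing ht hi' hj' hr hr1 hr0 ?_ ?_ ?_ ?_
  · exact h.same c i (i + 1) j (by omega) (by omega) hj
  · exact h.chord c (c + 1) (i + 1) j 0 hc (by omega) hj h0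
  · rw [orient_rotate]
    exact h.chord c (c + 1) i j 0 hc hij hj h0
  · rw [← orient_rotate]
    exact h.chord c (c + 1) i (i + 1) 0 hc (by omega) (by omega) h0

lemma eq_of_card_eq_three {α : Type*} {t r : Finset α} {a b c : α} (hab : a ≠ b) (hac : a ≠ c)
    (hbc : b ≠ c) (ht : t.card = 3) (hr : r.card = 3) (hat : a ∈ t) (hbt : b ∈ t) (hct : c ∈ t)
    (har : a ∈ r) (hbr : b ∈ r) (hcr : c ∈ r) : t = r := by
  classical
  have h3 : ({a, b, c} : Finset α).card = 3 := Finset.card_eq_three.2 ⟨a, b, c, hab, hac, hbc, rfl⟩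
  have h1 : ({a, b, c} : Finset α) = t :=
    Finset.eq_of_subset_of_card_le (by simp [Finset.insert_subset_iff, hat, hbt, hct]) (by omega)
  have h2 : ({a, b, c} : Finset α) = r :=
    Finset.eq_of_subset_of_card_le (by simp [Finset.insert_subset_iff, har, hbr, hcr]) (by omega)
  exact h1.symm.trans h2

/-- A triangle is either one of the fan triangles, or the triangle spanned by the first points of
the three clusters. -/
lemma IsThreeFan.fan_or_center (h : IsThreeFan N p) (hN : ∀ c, 2 ≤ N c) (hk : ∀ c, k < N c)
    (hK : IsOrderDelaunay (clusterPoints N p) k K) {t : Finset Plane} (ht : t ∈ K.faces)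
    (hcard : t.card = 3) :
    (∃ c s, s + 1 < N c ∧ p c s ∈ t ∧ p c (s + 1) ∈ t ∧ p (c + 1) 0 ∈ t) ∨ ∀ c, p c 0 ∈ t := by
  by_cases hex : ∃ c i j, i < j ∧ j < N c ∧ p c i ∈ t ∧ p c j ∈ t
  · left
    obtain ⟨c, i, j, hij, hj, hi', hj'⟩ := hex
    obtain ⟨l, hl, hl'⟩ := h.exists_third hN hk hK ht hcard hij hj hi' hj'
    obtain rfl := h.apex_eq_zero hN hk hK ht hj hl hj' hl'
    obtain rfl := h.succ_eq hN hk hK ht hij hj hi' hj'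
    exact ⟨c, i, hj, hi', hj', hl'⟩
  · right
    have hcl : ∀ c i j, i < N c → j < N c → p c i ∈ t → p c j ∈ t → i = j := by
      intro c i j hi hj hi' hj'
      rcases lt_trichotomy i j with hlt | heq | hlt
      · exact absurd ⟨c, i, j, hlt, hj, hi', hj'⟩ hex
      · exact heq
      · exact absurd ⟨c, j, i, hlt, hi, hj', hi'⟩ hex
    obtain ⟨x, y, z, hxy, hxz, hyz, hxyz⟩ := Finset.card_eq_three.1 hcard
    have hsub := hK.isTriangulation.subset ht
    have hx : x ∈ t := by simp [hxyz]
    have hy : y ∈ t := by simp [hxyz]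
    have hz : z ∈ t := by simp [hxyz]
    obtain ⟨c₁, i₁, h₁, rfl⟩ := mem_clusterPoints.1 (hsub hx)
    obtain ⟨c₂, i₂, h₂, rfl⟩ := mem_clusterPoints.1 (hsub hy)
    obtain ⟨c₃, i₃, h₃, rfl⟩ := mem_clusterPoints.1 (hsub hz)
    have h12 : c₁ ≠ c₂ := by
      rintro rfl; exact hxy (by rw [hcl c₁ i₁ i₂ h₁ h₂ hx hy])
    have h13 : c₁ ≠ c₃ := by
      rintro rfl; exact hxz (by rw [hcl c₁ i₁ i₃ h₁ h₃ hx hz])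
    have h23 : c₂ ≠ c₃ := by
      rintro rfl; exact hyz (by rw [hcl c₂ i₂ i₃ h₂ h₃ hy hz])
    have hall : ∀ c, ∃ i < N c, p c i ∈ t := by
      intro c
      have hc : c = c₁ ∨ c = c₂ ∨ c = c₃ := by
        revert h12 h13 h23; clear * -; revert c c₁ c₂ c₃; decide
      rcases hc with rfl | rfl | rfl
      · exact ⟨i₁, h₁, hx⟩
      · exact ⟨i₂, h₂, hy⟩
      · exact ⟨i₃, h₃, hz⟩
    have hsucc : ∀ c, p (c + 1) 0 ∈ t := by
      intro c
      obtain ⟨i, hi, hi'⟩ := hall c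
      obtain ⟨j, hj, hj'⟩ := hall (c + 1)
      rwa [h.apex_eq_zero hN hk hK ht hi hj hi' hj'] at hj'
    intro c
    have hc : c + 2 + 1 = c := by revert c; clear * -; decide
    rw [← hc]
    exact hsucc (c + 2)

/-- Two order-`k` Delaunay triangulations share all fan triangles, hence can differ in the central
triangle only. So the triangles of one of them are triangles of the other one. -/
theorem IsThreeFan.orderDelaunay_unique (h : IsThreeFan N p) (hN : ∀ c, 2 ≤ N c)
    (hk : ∀ c, k < N c) {D : Geometry.SimplicialComplex ℝ Plane}
    (hK : IsOrderDelaunay (clusterPoints N p) k K)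
    (hD : IsOrderDelaunay (clusterPoints N p) k D) : K = D := by
  have hfan : ∀ {K D : Geometry.SimplicialComplex ℝ Plane},
      IsOrderDelaunay (clusterPoints N p) k K → IsOrderDelaunay (clusterPoints N p) k D →
      ∀ t ∈ K.faces, t.card = 3 → t ∈ D.faces ∨ ∀ c, p c 0 ∈ t := by
    intro K D hK hD t ht hcard
    rcases h.fan_or_center hN hk hK ht hcard with ⟨c, s, hs, h1, h2, h3⟩ | hcen
    · left
      obtain ⟨r, hr, hrc, hr1, hr2, hr3⟩ := h.exists_fan_triangle hN hk hD hs
      have h0 : 0 < N (c + 1) := by have := hN (c + 1); omega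
      have hc := (fin_three_add_one_ne c).symm
      rwa [eq_of_card_eq_three (h.ne_of_lt hN (Nat.lt_succ_self s) hs)
        (h.ne_of_ne hN hc (by omega) h0) (h.ne_of_ne hN hc hs h0) hcard hrc h1 h2 h3 hr1 hr2 hr3]
    · exact Or.inr hcen
  have hp0 : ∀ c, 0 < N c := fun c => by have := hN c; omega
  by_cases hcen : ∃ t ∈ D.faces, t.card = 3 ∧ ∀ c, p c 0 ∈ t
  · obtain ⟨r, hr, hrc, hr'⟩ := hcen
    refine hK.isTriangulation.eq_of_triangles hD.isTriangulation fun t ht hcard => ?_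
    rcases hfan hK hD t ht hcard with h' | h'
    · exact h'
    · rwa [eq_of_card_eq_three (h.ne_of_ne hN (by decide : (0 : Fin 3) ≠ 1) (hp0 0) (hp0 1))
        (h.ne_of_ne hN (by decide : (0 : Fin 3) ≠ 2) (hp0 0) (hp0 2))
        (h.ne_of_ne hN (by decide : (1 : Fin 3) ≠ 2) (hp0 1) (hp0 2)) hcard hrc
        (h' 0) (h' 1) (h' 2) (hr' 0) (hr' 1) (hr' 2)]
  · refine (hD.isTriangulation.eq_of_triangles hK.isTriangulation fun t ht hcard => ?_).symm
    exact (hfan hD hK t ht hcard).resolve_right fun h' => hcen ⟨t, ht, hcard, h'⟩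

end ThreeFan

lemma IsDelaunay.isOrderDelaunay {P : Finset Plane} {D : Geometry.SimplicialComplex ℝ Plane}
    (h : IsDelaunay P D) (k : ℕ) : IsOrderDelaunay P k D := by
  refine ⟨h.isTriangulation, fun t ht hcard => ?_⟩
  obtain ⟨C, htC, hC⟩ := h.empty_circle t ht hcard
  refine ⟨C, htC, ?_⟩
  rw [Finset.filter_false_of_mem fun p hp => not_lt.2 (hC p hp), Finset.card_empty]
  exact Nat.zero_le k

/-! ### Perturbation into general position -/

lemma dense_ne_zero_of_analytic {E : Type*} [NormedAddCommGroup E] [NormedSpace ℝ E] {f : E → ℝ}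
    (hf : AnalyticOnNhd ℝ f Set.univ) (hne : ∃ x, f x ≠ 0) : Dense {x | f x ≠ 0} := by
  rw [← Set.compl_ofPred, ← interior_eq_empty_iff_dense_compl, Set.eq_empty_iff_forall_notMem]
  intro x hx
  obtain ⟨y, hy⟩ := hne
  have h0 : f =ᶠ[𝓝 x] 0 := mem_interior_iff_mem_nhds.1 hx
  exact hy (hf.eqOn_zero_of_preconnected_of_eventuallyEq_zero isPreconnected_univ
    (Set.mem_univ x) h0 (Set.mem_univ y))

section Generic

variable {ι : Type*} [Fintype ι]

lemma analyticOnNhd_coord (i : ι) (j : Fin 2) :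
    AnalyticOnNhd ℝ (fun q : ι → Plane => q i j) Set.univ :=
  ((EuclideanSpace.proj j : Plane →L[ℝ] ℝ).comp
    (ContinuousLinearMap.proj i : (ι → Plane) →L[ℝ] Plane)).analyticOnNhd _

lemma analyticOnNhd_orient (i j k : ι) :
    AnalyticOnNhd ℝ (fun q : ι → Plane => orient (q i) (q j) (q k)) Set.univ := by
  have h := analyticOnNhd_coord (ι := ι)
  unfold orient
  exact (((h j 0).sub (h i 0)).mul ((h k 1).sub (h i 1))).sub
    (((h j 1).sub (h i 1)).mul ((h k 0).sub (h i 0)))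

lemma analyticOnNhd_incirc (i j k l : ι) :
    AnalyticOnNhd ℝ (fun q : ι → Plane => incirc (q i) (q j) (q k) (q l)) Set.univ := by
  have h := analyticOnNhd_coord (ι := ι)
  have hn := fun a b : ι => (((h a 0).sub (h b 0)).pow 2).add (((h a 1).sub (h b 1)).pow 2)
  have ho := analyticOnNhd_orient (ι := ι)
  unfold incirc
  exact ((((hn i l).mul (ho l j k)).sub ((hn j l).mul (ho l i k))).add
    ((hn k l).mul (ho l i j)))

/-- Every nonempty open set of configurations contains one without collinear triples and
cocircular quadruples. -/
lemma exists_mem_open_generic {U : Set (ι → Plane)} (hU : IsOpen U) (hne : U.Nonempty) :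
    ∃ q ∈ U, (∀ i j k, i ≠ j → i ≠ k → j ≠ k → orient (q i) (q j) (q k) ≠ 0) ∧
      ∀ i j k l, i ≠ j → i ≠ k → i ≠ l → j ≠ k → j ≠ l → k ≠ l →
        incirc (q i) (q j) (q k) (q l) ≠ 0 := by
  classical
  have hS : ∀ x : {x : ι × ι × ι // x.1 ≠ x.2.1 ∧ x.1 ≠ x.2.2 ∧ x.2.1 ≠ x.2.2},
      IsOpen {q : ι → Plane | orient (q x.1.1) (q x.1.2.1) (q x.1.2.2) ≠ 0} ∧
      Dense {q : ι → Plane | orient (q x.1.1) (q x.1.2.1) (q x.1.2.2) ≠ 0} := by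
    rintro ⟨⟨i, j, k⟩, hij, hik, hjk⟩
    have ha := analyticOnNhd_orient i j k
    refine ⟨isOpen_ne_fun (continuousOn_univ.1 ha.continuousOn) continuous_const,
      dense_ne_zero_of_analytic ha
        ⟨fun x => if x = j then !₂[1, 0] else if x = k then !₂[0, 1] else 0, ?_⟩⟩
    simp only at hij hik hjk
    simp [hij, hik, hjk.symm, orient]
  have hT : ∀ x : {x : ι × ι × ι × ι // x.1 ≠ x.2.1 ∧ x.1 ≠ x.2.2.1 ∧ x.1 ≠ x.2.2.2 ∧
      x.2.1 ≠ x.2.2.1 ∧ x.2.1 ≠ x.2.2.2 ∧ x.2.2.1 ≠ x.2.2.2},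
      IsOpen {q : ι → Plane |
        incirc (q x.1.1) (q x.1.2.1) (q x.1.2.2.1) (q x.1.2.2.2) ≠ 0} ∧
      Dense {q : ι → Plane |
        incirc (q x.1.1) (q x.1.2.1) (q x.1.2.2.1) (q x.1.2.2.2) ≠ 0} := by
    -- `(2, 2)` is not on the circle through `(0, 0)`, `(1, 0)`, `(0, 1)`
    rintro ⟨⟨i, j, k, l⟩, hij, hik, hil, hjk, hjl, hkl⟩
    have ha := analyticOnNhd_incirc i j k l
    refine ⟨isOpen_ne_fun (continuousOn_univ.1 ha.continuousOn) continuous_const,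
      dense_ne_zero_of_analytic ha ⟨fun x => if x = j then !₂[1, 0] else if x = k then !₂[0, 1]
        else if x = l then !₂[2, 2] else 0, ?_⟩⟩
    simp only at hij hik hil hjk hjl hkl
    simp only [hij, hik, hil, hjk.symm, hjl.symm, hkl.symm, if_true, if_false]
    simp [incirc, orient]
    norm_num
  have hd := (dense_iInter_of_isOpen (fun x => (hS x).1) fun x => (hS x).2).inter_of_isOpen_left
    (dense_iInter_of_isOpen (fun x => (hT x).1) fun x => (hT x).2)
    (isOpen_iInter_of_finite fun x => (hS x).1)
  obtain ⟨q, hqU, hq₁, hq₂⟩ := hd.inter_open_nonempty U hU hne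
  refine ⟨q, hqU, fun i j k hij hik hjk => ?_, fun i j k l hij hik hil hjk hjl hkl => ?_⟩
  · exact Set.mem_iInter.1 hq₁ ⟨(i, j, k), hij, hik, hjk⟩
  · exact Set.mem_iInter.1 hq₂ ⟨(i, j, k, l), hij, hik, hil, hjk, hjl, hkl⟩

lemma continuous_orient (i j k : ι) :
    Continuous fun q : ι → Plane => orient (q i) (q j) (q k) :=
  continuousOn_univ.1 (analyticOnNhd_orient i j k).continuousOn

lemma continuous_incirc (i j k l : ι) :
    Continuous fun q : ι → Plane => incirc (q i) (q j) (q k) (q l) :=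
  continuousOn_univ.1 (analyticOnNhd_incirc i j k l).continuousOn

end Generic

/-- The configuration `q` of finitely many points, extended by a junk value beyond the sizes of the
clusters. -/
noncomputable def extendPoints (N : Fin 3 → ℕ) (q : (Σ c, Fin (N c)) → Plane) (c : Fin 3) (s : ℕ) :
    Plane :=
  if h : s < N c then q ⟨c, s, h⟩ else 0

lemma extendPoints_of_lt {N : Fin 3 → ℕ} (q : (Σ c, Fin (N c)) → Plane) {c : Fin 3} {s : ℕ}
    (h : s < N c) : extendPoints N q c s = q ⟨c, s, h⟩ := dif_pos h

/-- The strict inequalities defining `IsThreeFan` survive small perturbations. -/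
lemma IsThreeFan.eventually {N : Fin 3 → ℕ} {p : Fin 3 → ℕ → Plane} (h : IsThreeFan N p) :
    ∀ᶠ q in 𝓝 (fun x : (Σ c, Fin (N c)) => p x.1 x.2), IsThreeFan N (extendPoints N q) := by
  have ho := fun i j k => continuous_orient (ι := Σ c, Fin (N c)) i j k
  have hi := fun i j k l => continuous_incirc (ι := Σ c, Fin (N c)) i j k l
  have h1 : ∀ᶠ q in 𝓝 (fun x : (Σ c, Fin (N c)) => p x.1 x.2),
      ∀ (c : Fin 3) (s t u : Fin (N c)), s < t → t < u →
        0 < orient (q ⟨c, s⟩) (q ⟨c, t⟩) (q ⟨c, u⟩) := by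
    simp only [eventually_all]
    intro c s t u hst htu
    exact (ho _ _ _).continuousAt.eventually_const_lt (h.same c s t u hst htu u.2)
  have h2 : ∀ᶠ q in 𝓝 (fun x : (Σ c, Fin (N c)) => p x.1 x.2),
      ∀ (c c' : Fin 3) (s t : Fin (N c)) (u : Fin (N c')), c' ≠ c → s < t →
        0 < orient (q ⟨c, s⟩) (q ⟨c, t⟩) (q ⟨c', u⟩) := by
    simp only [eventually_all]
    intro c c' s t u hc hst
    exact (ho _ _ _).continuousAt.eventually_const_lt (h.chord c c' s t u hc hst t.2 u.2)
  have h3 : ∀ᶠ q in 𝓝 (fun x : (Σ c, Fin (N c)) => p x.1 x.2),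
      ∀ (c : Fin 3) (s : Fin (N c)) (t : Fin (N (c + 1))) (u : Fin (N (c + 2))),
        0 < orient (q ⟨c, s⟩) (q ⟨c + 1, t⟩) (q ⟨c + 2, u⟩) := by
    simp only [eventually_all]
    intro c s t u
    exact (ho _ _ _).continuousAt.eventually_const_lt (h.mixed c s t u s.2 t.2 u.2)
  have h4 : ∀ᶠ q in 𝓝 (fun x : (Σ c, Fin (N c)) => p x.1 x.2),
      ∀ (c : Fin 3) (s t u : Fin (N c)) (v : Fin (N (c + 1))), s < t → t < u →
        0 < incirc (q ⟨c, s⟩) (q ⟨c, t⟩) (q ⟨c, u⟩) (q ⟨c + 1, v⟩) := by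
    simp only [eventually_all]
    intro c s t u v hst htu
    exact (hi _ _ _ _).continuousAt.eventually_const_lt
      (h.incirc_same c s t u v hst htu u.2 v.2)
  have h5 : ∀ᶠ q in 𝓝 (fun x : (Σ c, Fin (N c)) => p x.1 x.2),
      ∀ (c : Fin 3) (s t : Fin (N c)) (u : Fin (N (c + 2))) (v : Fin (N (c + 1))), s < t →
        0 < incirc (q ⟨c, s⟩) (q ⟨c, t⟩) (q ⟨c + 2, u⟩) (q ⟨c + 1, v⟩) := by
    simp only [eventually_all]
    intro c s t u v hst
    exact (hi _ _ _ _).continuousAt.eventually_const_lt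
      (h.incirc_chord c s t u v hst t.2 u.2 v.2)
  filter_upwards [h1, h2, h3, h4, h5] with q h1 h2 h3 h4 h5
  constructor
  · intro c s t u hst htu hu
    have ht := htu.trans hu
    have hs := hst.trans ht
    rw [extendPoints_of_lt q hs, extendPoints_of_lt q ht, extendPoints_of_lt q hu]
    exact h1 c ⟨s, hs⟩ ⟨t, ht⟩ ⟨u, hu⟩ hst htu
  · intro c c' s t u hc hst ht hu
    have hs := hst.trans ht
    rw [extendPoints_of_lt q hs, extendPoints_of_lt q ht, extendPoints_of_lt q hu]
    exact h2 c c' ⟨s, hs⟩ ⟨t, ht⟩ ⟨u, hu⟩ hc hst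
  · intro c s t u hs ht hu
    rw [extendPoints_of_lt q hs, extendPoints_of_lt q ht, extendPoints_of_lt q hu]
    exact h3 c ⟨s, hs⟩ ⟨t, ht⟩ ⟨u, hu⟩
  · intro c s t u v hst htu hu hv
    have ht := htu.trans hu
    have hs := hst.trans ht
    rw [extendPoints_of_lt q hs, extendPoints_of_lt q ht, extendPoints_of_lt q hu,
      extendPoints_of_lt q hv]
    exact h4 c ⟨s, hs⟩ ⟨t, ht⟩ ⟨u, hu⟩ ⟨v, hv⟩ hst htu
  · intro c s t u v hst ht hu hv
    have hs := hst.trans ht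
    rw [extendPoints_of_lt q hs, extendPoints_of_lt q ht, extendPoints_of_lt q hu,
      extendPoints_of_lt q hv]
    exact h5 c ⟨s, hs⟩ ⟨t, ht⟩ ⟨u, hu⟩ ⟨v, hv⟩ hst

/-- A three-cluster configuration can be perturbed into general position. -/
lemma IsThreeFan.exists_generic {N : Fin 3 → ℕ} {p : Fin 3 → ℕ → Plane} (h : IsThreeFan N p) :
    ∃ p', IsThreeFan N p' ∧ InGeneralPosition (clusterPoints N p') := by
  obtain ⟨U, hU, hUo, hmem⟩ := eventually_nhds_iff.1 h.eventually
  obtain ⟨q, hqU, hq₁, hq₂⟩ := exists_mem_open_generic hUo ⟨_, hmem⟩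
  have hpt : ∀ x ∈ clusterPoints N (extendPoints N q), ∃ i, q i = x := by
    intro x hx
    obtain ⟨c, s, hs, rfl⟩ := mem_clusterPoints.1 hx
    exact ⟨⟨c, s, hs⟩, (extendPoints_of_lt q hs).symm⟩
  refine ⟨extendPoints N q, hU q hqU, fun t ht hcard hcol => ?_, fun t ht hcard hcos => ?_⟩
  · classical
    obtain ⟨x, y, z, hxy, hxz, hyz, rfl⟩ := Finset.card_eq_three.1 hcard
    obtain ⟨i, rfl⟩ := hpt x (ht (by simp))
    obtain ⟨j, rfl⟩ := hpt y (ht (by simp))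
    obtain ⟨l, rfl⟩ := hpt z (ht (by simp))
    refine hq₁ i j l (ne_of_apply_ne q hxy) (ne_of_apply_ne q hxz) (ne_of_apply_ne q hyz) ?_
    exact orient_eq_zero_of_collinear (by simpa using hcol)
  · classical
    obtain ⟨x, y, z, w, hxy, hxz, hxw, hyz, hyw, hzw, rfl⟩ := Finset.card_eq_four.1 hcard
    obtain ⟨i, rfl⟩ := hpt x (ht (by simp))
    obtain ⟨j, rfl⟩ := hpt y (ht (by simp))
    obtain ⟨l, rfl⟩ := hpt z (ht (by simp))
    obtain ⟨m, rfl⟩ := hpt w (ht (by simp))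
    refine hq₂ i j l m (ne_of_apply_ne q hxy) (ne_of_apply_ne q hxz) (ne_of_apply_ne q hxw)
      (ne_of_apply_ne q hyz) (ne_of_apply_ne q hyw) (ne_of_apply_ne q hzw) ?_
    exact incirc_eq_zero_of_cospherical (by simpa using hcos)

/-! ### A configuration of three short circular arcs -/

/-- The points `(0, 0)`, `(1, 0)`, `(0, 1)` around which the clusters concentrate. -/
noncomputable def corner (c : Fin 3) : Plane :=
  !₂[![0, 1, 0] c, ![0, 0, 1] c]

/-- The centre of the circle carrying cluster `c`. This circle passes through `corner c`, encloses
`corner (c + 1)` and excludes `corner (c + 2)`. -/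
noncomputable def arcCenter (c : Fin 3) : Plane :=
  !₂[![3 / 5, 3 / 5, 3 / 10] c, ![2 / 5, 7 / 10, 2 / 5] c]

/-- The squared radius of the circle carrying cluster `c`. -/
noncomputable def arcRadiusSq (c : Fin 3) : ℝ :=
  (corner c 0 - arcCenter c 0) ^ 2 + (corner c 1 - arcCenter c 1) ^ 2

/-- The rational parametrization of the circle carrying cluster `c`, starting at `corner c`. -/
noncomputable def arc (c : Fin 3) (t : ℝ) : Plane :=
  !₂[arcCenter c 0 + ((1 - t ^ 2) * (corner c 0 - arcCenter c 0)
      - 2 * t * (corner c 1 - arcCenter c 1)) / (1 + t ^ 2),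
    arcCenter c 1 + ((1 - t ^ 2) * (corner c 1 - arcCenter c 1)
      + 2 * t * (corner c 0 - arcCenter c 0)) / (1 + t ^ 2)]

lemma arc_zero (c : Fin 3) : arc c 0 = corner c := by
  ext i
  fin_cases i <;> simp [arc]

lemma continuous_arc_coord (c : Fin 3) (i : Fin 2) : Continuous fun t => arc c t i := by
  have h : ∀ t : ℝ, 1 + t ^ 2 ≠ 0 := fun t => by positivity
  fin_cases i
  · simp only [arc, Fin.zero_eta, PiLp.toLp_apply, Matrix.cons_val_zero]
    fun_prop (disch := exact h)
  · simp only [arc, Fin.mk_one, PiLp.toLp_apply, Matrix.cons_val_one]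
    fun_prop (disch := exact h)

lemma norm_arc_sub_sq (c : Fin 3) (t : ℝ) : ‖arc c t - arcCenter c‖ ^ 2 = arcRadiusSq c := by
  rw [norm_sub_sq_eq, arcRadiusSq]
  simp only [arc, PiLp.toLp_apply, Matrix.cons_val_zero, Matrix.cons_val_one]
  field_simp
  ring

lemma arcRadiusSq_pos (c : Fin 3) : 0 < arcRadiusSq c := by
  fin_cases c <;> norm_num [arcRadiusSq, corner, arcCenter]

lemma orient_arc (c : Fin 3) (s t u : ℝ) : orient (arc c s) (arc c t) (arc c u) =
    4 * arcRadiusSq c * ((t - s) * (u - t) * (u - s)) /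
      ((1 + s ^ 2) * (1 + t ^ 2) * (1 + u ^ 2)) := by
  simp only [orient, arc, arcRadiusSq, PiLp.toLp_apply, Matrix.cons_val_zero, Matrix.cons_val_one]
  field_simp
  ring

lemma corner_inequalities (c : Fin 3) :
    0 < orient (corner c) (corner (c + 1)) (corner (c + 2)) ∧
    (corner (c + 1) 0 - arcCenter c 0) ^ 2 + (corner (c + 1) 1 - arcCenter c 1) ^ 2
      < arcRadiusSq c ∧
    arcRadiusSq c
      < (corner (c + 2) 0 - arcCenter c 0) ^ 2 + (corner (c + 2) 1 - arcCenter c 1) ^ 2 := by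
  have h11 : (1 : Fin 3) + 1 = 2 := rfl
  have h12 : (1 : Fin 3) + 2 = 0 := rfl
  have h21 : (2 : Fin 3) + 1 = 0 := rfl
  have h22 : (2 : Fin 3) + 2 = 1 := rfl
  have hc : c = 0 ∨ c = 1 ∨ c = 2 := fin_three_cases 0 c
  rcases hc with rfl | rfl | rfl <;>
    simp [h11, h12, h21, h22, orient, arcRadiusSq, corner, arcCenter] <;> norm_num

/-- The orientation of a chord of an arc and a further point `q`, divided by the length of the
parameter interval. At `s = t = 0` it measures the distance of `q` from the tangent. -/
noncomputable def chordSlope (c : Fin 3) (s t : ℝ) (q : Plane) : ℝ :=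
  (-(s + t) * (corner c 0 - arcCenter c 0) - (1 - s * t) * (corner c 1 - arcCenter c 1)) *
      (q 1 - arc c s 1) -
    (-(s + t) * (corner c 1 - arcCenter c 1) + (1 - s * t) * (corner c 0 - arcCenter c 0)) *
      (q 0 - arc c s 0)

lemma orient_arc_chord (c : Fin 3) (s t : ℝ) (q : Plane) : orient (arc c s) (arc c t) q =
    2 * (t - s) / ((1 + s ^ 2) * (1 + t ^ 2)) * chordSlope c s t q := by
  simp only [orient, chordSlope, arc, PiLp.toLp_apply, Matrix.cons_val_zero, Matrix.cons_val_one]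
  field_simp
  ring

/-- For small parameters all inequalities hold that hold strictly at the corners. -/
lemma exists_small_arcs : ∃ δ > 0, ∀ s t u : ℝ, |s| < δ → |t| < δ → |u| < δ → ∀ c : Fin 3,
    (∀ c', c' ≠ c → 0 < chordSlope c s t (arc c' u)) ∧
    0 < orient (arc c s) (arc (c + 1) t) (arc (c + 2) u) ∧
    ‖arc (c + 1) s - arcCenter c‖ ^ 2 < arcRadiusSq c ∧
    arcRadiusSq c < ‖arc (c + 2) s - arcCenter c‖ ^ 2 := by
  have hs : ∀ c i, Continuous fun x : ℝ × ℝ × ℝ => arc c x.1 i := fun c i =>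
    (continuous_arc_coord c i).comp (by fun_prop)
  have ht : ∀ c i, Continuous fun x : ℝ × ℝ × ℝ => arc c x.2.1 i := fun c i =>
    (continuous_arc_coord c i).comp (by fun_prop)
  have hu : ∀ c i, Continuous fun x : ℝ × ℝ × ℝ => arc c x.2.2 i := fun c i =>
    (continuous_arc_coord c i).comp (by fun_prop)
  have key : ∀ᶠ x : ℝ × ℝ × ℝ in 𝓝 0, ∀ c : Fin 3,
      (∀ c', c' ≠ c → 0 < chordSlope c x.1 x.2.1 (arc c' x.2.2)) ∧
      0 < orient (arc c x.1) (arc (c + 1) x.2.1) (arc (c + 2) x.2.2) ∧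
      ‖arc (c + 1) x.1 - arcCenter c‖ ^ 2 < arcRadiusSq c ∧
      arcRadiusSq c < ‖arc (c + 2) x.1 - arcCenter c‖ ^ 2 := by
    simp only [eventually_all, eventually_and, norm_sub_sq_eq]
    intro c
    have h1 := hs c
    have h1' := hs (c + 1)
    have h1'' := hs (c + 2)
    have h2 := ht (c + 1)
    have h3 := hu (c + 2)
    refine ⟨fun c' hc => ?_, ?_, ?_, ?_⟩
    · have h4 := hu c'
      refine Filter.Tendsto.eventually_const_lt ?_ (Continuous.tendsto ?_ 0)
      · simp only [Prod.fst_zero, Prod.snd_zero, chordSlope, arc_zero]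
        fin_cases c <;> fin_cases c' <;> first
          | exact absurd rfl hc
          | norm_num [corner, arcCenter]
      · unfold chordSlope
        exact (((by fun_prop : Continuous fun x : ℝ × ℝ × ℝ =>
          (-(x.1 + x.2.1) * (corner c 0 - arcCenter c 0)
            - (1 - x.1 * x.2.1) * (corner c 1 - arcCenter c 1)))).mul ((h4 1).sub (h1 1))).sub
          ((by fun_prop : Continuous fun x : ℝ × ℝ × ℝ =>
          (-(x.1 + x.2.1) * (corner c 1 - arcCenter c 1)
            + (1 - x.1 * x.2.1) * (corner c 0 - arcCenter c 0))).mul ((h4 0).sub (h1 0)))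
    · refine Filter.Tendsto.eventually_const_lt ?_ (Continuous.tendsto ?_ 0)
      · simpa only [Prod.fst_zero, Prod.snd_zero, arc_zero] using (corner_inequalities c).1
      · unfold orient
        exact (((h2 0).sub (h1 0)).mul ((h3 1).sub (h1 1))).sub
          (((h2 1).sub (h1 1)).mul ((h3 0).sub (h1 0)))
    · refine Filter.Tendsto.eventually_lt_const ?_ (Continuous.tendsto ?_ 0)
      · simpa only [Prod.fst_zero, arc_zero] using (corner_inequalities c).2.1
      · exact (((h1' 0).sub continuous_const).pow 2).add (((h1' 1).sub continuous_const).pow 2)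
    · refine Filter.Tendsto.eventually_const_lt ?_ (Continuous.tendsto ?_ 0)
      · simpa only [Prod.fst_zero, arc_zero] using (corner_inequalities c).2.2
      · exact (((h1'' 0).sub continuous_const).pow 2).add (((h1'' 1).sub continuous_const).pow 2)
  obtain ⟨δ, hδ, h⟩ := Metric.eventually_nhds_iff.1 key
  refine ⟨δ, hδ, fun s t u hs ht hu => ?_⟩
  exact h (y := (s, t, u)) (by
    simp only [dist_zero_right, Prod.norm_def, Real.norm_eq_abs]
    exact max_lt hs (max_lt ht hu))

/-- Points on three sufficiently short arcs form a three-cluster configuration. -/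
lemma exists_isThreeFan (N : Fin 3 → ℕ) : ∃ p, IsThreeFan N p := by
  obtain ⟨δ, hδ, h⟩ := exists_small_arcs
  set M : ℕ := N 0 + N 1 + N 2 with hM
  have hNM : ∀ c, N c ≤ M := by
    intro c
    fin_cases c <;> simp [hM] <;> omega
  set τ : ℕ → ℝ := fun s => δ * (s / (M + 1)) with hτ
  have hτlt : ∀ c s, s < N c → |τ s| < δ := fun c s hs => by
    have h1 : (s : ℝ) < M + 1 := by
      have := hNM c
      exact_mod_cast (by omega : s < M + 1)
    have h2 : (s : ℝ) / (M + 1) < 1 := by rw [div_lt_one (by positivity)]; exact h1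
    rw [abs_of_nonneg (by simp only [hτ]; positivity)]
    simp only [hτ]
    nlinarith
  have hmono : ∀ s t, s < t → τ s < τ t := fun s t hst => by
    have : (s : ℝ) < t := by exact_mod_cast hst
    simp only [hτ]
    gcongr
  have hsame : ∀ c s t u, s < t → t < u →
      0 < orient (arc c (τ s)) (arc c (τ t)) (arc c (τ u)) := fun c s t u hst htu => by
    rw [orient_arc]
    have h1 := sub_pos.2 (hmono s t hst)
    have h2 := sub_pos.2 (hmono t u htu)
    have h3 := sub_pos.2 (hmono s u (hst.trans htu))
    have h4 := arcRadiusSq_pos c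
    positivity
  have hchord : ∀ c c' s t u, c' ≠ c → s < t → t < N c → u < N c' →
      0 < orient (arc c (τ s)) (arc c (τ t)) (arc c' (τ u)) := fun c c' s t u hc hst ht hu => by
    rw [orient_arc_chord]
    have h1 := sub_pos.2 (hmono s t hst)
    have h2 := (h (τ s) (τ t) (τ u) (hτlt c s (hst.trans ht)) (hτlt c t ht) (hτlt c' u hu) c).1
      c' hc
    positivity
  have hin : ∀ c v, v < N (c + 1) → ‖arc (c + 1) (τ v) - arcCenter c‖ ^ 2 < arcRadiusSq c :=
    fun c v hv => by
      have hv' := hτlt _ v hv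
      exact (h (τ v) (τ v) (τ v) hv' hv' hv' c).2.2.1
  have hout : ∀ c v, v < N (c + 2) → arcRadiusSq c < ‖arc (c + 2) (τ v) - arcCenter c‖ ^ 2 :=
    fun c v hv => by
      have hv' := hτlt _ v hv
      exact (h (τ v) (τ v) (τ v) hv' hv' hv' c).2.2.2
  refine ⟨fun c s => arc c (τ s), fun c s t u hst htu _ => hsame c s t u hst htu, hchord,
    fun c s t u hs ht hu => ?_, fun c s t u v hst htu hu hv => ?_,
    fun c s t u v hst ht hu hv => ?_⟩
  · exact (h _ _ _ (hτlt _ s hs) (hτlt _ t ht) (hτlt _ u hu) c).2.1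
  · rw [incirc_eq _ _ _ _ (arcCenter c) (arcRadiusSq c)]
    simp only [norm_arc_sub_sq, sub_self, zero_mul, zero_add]
    nlinarith [mul_pos (sub_pos.2 (hin c v hv)) (hsame c s t u hst htu)]
  · rw [incirc_eq _ _ _ _ (arcCenter c) (arcRadiusSq c)]
    simp only [norm_arc_sub_sq, sub_self, zero_mul, zero_add]
    have h1 := hchord c (c + 2) s t u (fin_three_add_two_ne c) hst ht hu
    have h2 := hchord c (c + 1) s t v (fin_three_add_one_ne c) hst ht hv
    rw [← orient_rotate, ← orient_rotate] at h2
    nlinarith [mul_pos (sub_pos.2 (hin c v hv)) h1, mul_pos (sub_pos.2 (hout c u hu)) h2]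

/-- For `n ≥ 6` and `k ≤ ⌊n/3⌋ - 1` there is a set of `n` points in general position whose
only order-`k` Delaunay triangulation is its Delaunay triangulation. -/
theorem mainTheorem4 (n k : ℕ) (hn : 6 ≤ n) (hk : k ≤ n / 3 - 1) :
    ∃ P : Finset Plane, P.card = n ∧ InGeneralPosition P ∧
      ∃ D : Geometry.SimplicialComplex ℝ Plane, IsDelaunay P D ∧
        ∀ K : Geometry.SimplicialComplex ℝ Plane, IsOrderDelaunay P k K ↔ K = D := by
  set N : Fin 3 → ℕ := ![n / 3, n / 3, n - 2 * (n / 3)] with hN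
  have hge : ∀ c, n / 3 ≤ N c := by
    intro c
    fin_cases c <;> simp [hN]
    omega
  have h2 : ∀ c, 2 ≤ N c := fun c => by have := hge c; omega
  have hkN : ∀ c, k < N c := fun c => by have := hge c; omega
  obtain ⟨p₀, hp₀⟩ := exists_isThreeFan N
  obtain ⟨p, hp, hgen⟩ := hp₀.exists_generic
  have hcard : (clusterPoints N p).card = n := by
    rw [hp.card_clusterPoints h2]
    simp [hN]
    omega
  obtain ⟨D, hD⟩ := exists_isDelaunay hgen (by omega)
  refine ⟨clusterPoints N p, hcard, hgen, D, hD, fun K => ⟨fun hK => ?_, ?_⟩⟩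
  · exact hp.orderDelaunay_unique h2 hkN hK (hD.isOrderDelaunay k)
  · rintro rfl
    exact hD.isOrderDelaunay k
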